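/- For $j\in\mathbb N=\{1,2,\dots\}$ let $S_j(x)=\frac{1}{3^j}x+1-\frac{1}{3^{j-1}}$ for $x\in\mathbb R$, and $p_j=\frac1{2^j}$. Let $P$ be the unique Borel probability measure on $\mathbb R$ with $P=\sum_{j=1}^\infty p_j\,P\circ S_j^{-1}$. For a finite word $\omega=\omega_1\cdots\omega_m$ over $\mathbb N$ put $S_\omega=S_{\omega_1}\circ\cdots\circ S_{\omega_m}$, $p_\omega=p_{\omega_1}\cdots p_{\omega_m}$ (the identity and $1$ for the empty word), and $J_\omega=S_\omega([0,1])$. For nonempty $\omega$ let $\omega^-=\omega_1\cdots\omega_{m-1}$ and $J_{(\omega,\infty)}=\bigcup_{j\ge1}J_{\omega^-(\omega_m+j)}$. Write $a(\omega)=\frac1{P(J_\omega)}\int_{J_\omega}x\,dP(x)$ and $a(\omega,\infty)=\frac1{P(J_{(\omega,\infty)})}\int_{J_{(\omega,\infty)}}x\,dP(x)$ for the conditional expectations of a $P$-distributed random variable given these sets. For a nonempty finite set $\alpha\subset\mathbb R$ let $V(\alpha)=\int\min_{a\in\alpha}(x-a)^2\,dP(x)$, and for $n\ge1$ let $V_n$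 be the infimum of $V(\alpha)$ over all nonempty $\alpha\subset\mathbb R$ with at most $n$ points; $\alpha$ is an optimal set of $n$-means if it is nonempty, has at most $n$ points and $V(\alpha)=V_n$. Let $n=2^k$ with $k\ge1$. Then $$\alpha(k):=\{a(\omega):p_\omega=2^{-k}\}\cup\{a(\omega,\infty):p_\omega=2^{-k}\}$$ is an optimal set of $n$-means. For every $1\le j\le k$, the set $S_j^{-1}(\alpha(k)\cap J_j)$ is an optimal set of $2^{k-j}$-means. Moreover, $n=\sum_{j=1}^k2^{k-j}+1$ and $$V_n=\sum_{j=1}^k\frac1{18^j}V_{2^{k-j}}+\frac1{18^k}V_1.$$ -/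

import Mathlib

open MeasureTheory Set

noncomputable section

namespace CantorInf

/-! ### The infinite system of similarities and its coding by words over the positive integers -/

/-- The similarity `S_j x = x / 3 ^ j + 1 - 1 / 3 ^ (j - 1)`, for `j = 1, 2, ...`. -/
def S (j : ℕ+) (x : ℝ) : ℝ := 1 / 3 ^ (j : ℕ) * x + 1 - 1 / 3 ^ ((j : ℕ) - 1)

/-- The weight `p_j = 1 / 2 ^ j`. -/
def p (j : ℕ+) : ℝ := 1 / 2 ^ (j : ℕ)

/-- `S_ω = S_{ω₁} ∘ ... ∘ S_{ωₙ}` for a finite word `ω`; the identity for the empty word. -/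
def wordS : List ℕ+ → ℝ → ℝ
  | [] => id
  | j :: ω => S j ∘ wordS ω

/-- `p_ω = p_{ω₁} ⋯ p_{ωₙ}` for a finite word `ω`; `1` for the empty word. -/
def wordP (ω : List ℕ+) : ℝ := (ω.map p).prod

/-- The basic interval `J_ω = S_ω([0, 1])`. -/
def J (ω : List ℕ+) : Set ℝ := wordS ω '' Icc 0 1

/-- The set of words `(ω, ∞) = {ω⁻(ω_{|ω|} + j) : j = 1, 2, ...}`, where `ω⁻` is `ω` without its
last letter (no word at all if `ω` is empty). -/
def succWords (ω : List ℕ+) : Set (List ℕ+) :=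
  {τ | ∃ (h : ω ≠ []) (j : ℕ+), τ = ω.dropLast ++ [ω.getLast h + j]}

/-- `J_{(ω, ∞)}`, the union of the intervals `J_τ` over `τ ∈ (ω, ∞)`. -/
def JInf (ω : List ℕ+) : Set ℝ := ⋃ τ ∈ succWords ω, J τ

/-! ### The self-similar probability measure -/

/-- The equation `P = ∑_j p_j P ∘ S_j⁻¹`. -/
def IsSelfSimilar (P : Measure ℝ) : Prop :=
  P = Measure.sum fun j : ℕ+ => ENNReal.ofReal (p j) • P.map (S j)

/-- Every set of letters is measurable. -/
instance : MeasurableSpace ℕ+ := ⊤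

instance : DiscreteMeasurableSpace ℕ+ := ⟨fun _ => trivial⟩

/-- The probability vector `(1/2, 1/4, ...)` as a measure on the alphabet. -/
def letterMeasure : Measure ℕ+ := Measure.sum fun j : ℕ+ => ENNReal.ofReal (p j) • Measure.dirac j

/-- The first `n` letters of an infinite word. -/
def prefixWord (ω : ℕ → ℕ+) (n : ℕ) : List ℕ+ := List.ofFn fun i : Fin n => ω i

/-- The coding map: the limit of the increasing sequence `S_{ω₁⋯ωₙ}(0)`. By `iInter_J_prefixWord`
below, it is the only point of the intersection of the intervals `J_{ω₁⋯ωₙ}`. -/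
def coding (ω : ℕ → ℕ+) : ℝ := ⨆ n : ℕ, wordS (prefixWord ω n) 0

lemma p_pos (j : ℕ+) : 0 < p j := by unfold p; positivity

lemma tsum_ofReal_p : ∑' j : ℕ+, ENNReal.ofReal (p j) = 1 := by
  have h : HasSum p 1 := by
    have h1 : HasSum (fun n : ℕ => (1 / 2 : ℝ) / 2 ^ n) 1 := by
      simpa using hasSum_geometric_two' (1 : ℝ)
    rw [← Equiv.pnatEquivNat.symm.hasSum_iff]
    convert h1 using 2 with n
    simp only [Function.comp, p, Equiv.pnatEquivNat_symm_apply, Nat.succPNat_coe, Nat.succ_eq_add_one]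
    field_simp
    ring
  rw [← ENNReal.ofReal_tsum_of_nonneg (fun j => (p_pos j).le) h.summable, h.tsum_eq]
  simp

instance : IsProbabilityMeasure letterMeasure := by
  constructor
  simp [letterMeasure, tsum_ofReal_p]

lemma S_mono (j : ℕ+) : Monotone (S j) := by
  intro x y h
  unfold S
  gcongr

lemma S_continuous (j : ℕ+) : Continuous (S j) := by
  unfold S; fun_prop

lemma three_pow (j : ℕ+) : (3 : ℝ) ^ (j : ℕ) = 3 * 3 ^ ((j : ℕ) - 1) := by
  rw [← pow_succ', Nat.sub_add_cancel j.pos]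

lemma S_mem (j : ℕ+) {x : ℝ} (hx : x ∈ Icc (0 : ℝ) 1) : S j x ∈ Icc (0 : ℝ) 1 := by
  have h1 : (1 : ℝ) ≤ 3 ^ ((j : ℕ) - 1) := one_le_pow₀ (by norm_num)
  have h2 : (1 : ℝ) / 3 ^ ((j : ℕ) - 1) ≤ 1 := by
    rw [div_le_one (by positivity)]; exact h1
  have h3 : (1 : ℝ) / 3 ^ (j : ℕ) = 1 / 3 ^ ((j : ℕ) - 1) / 3 := by
    rw [three_pow]; field_simp
  have h4 : (0 : ℝ) < 1 / 3 ^ ((j : ℕ) - 1) := by positivity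
  unfold S
  rw [h3]
  constructor <;> nlinarith [hx.1, hx.2]

lemma wordS_mono (ω : List ℕ+) : Monotone (wordS ω) := by
  induction ω with
  | nil => exact monotone_id
  | cons j ω ih => exact (S_mono j).comp ih

lemma wordS_mem (ω : List ℕ+) {x : ℝ} (hx : x ∈ Icc (0 : ℝ) 1) : wordS ω x ∈ Icc (0 : ℝ) 1 := by
  induction ω with
  | nil => exact hx
  | cons j ω ih => exact S_mem j ih

lemma wordS_append (ω τ : List ℕ+) (x : ℝ) : wordS (ω ++ τ) x = wordS ω (wordS τ x) := by
  induction ω with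
  | nil => rfl
  | cons j ω ih => simp [wordS, ih]

lemma prefixWord_succ (ω : ℕ → ℕ+) (n : ℕ) :
    prefixWord ω (n + 1) = prefixWord ω n ++ [ω n] := by
  simp [prefixWord, List.ofFn_succ_last, -List.ofFn_succ]

lemma prefixWord_succ' (ω : ℕ → ℕ+) (n : ℕ) :
    prefixWord ω (n + 1) = ω 0 :: prefixWord (fun i => ω (i + 1)) n := by
  simp [prefixWord, List.ofFn_succ]

lemma wordS_prefix_mono (ω : ℕ → ℕ+) : Monotone fun n => wordS (prefixWord ω n) 0 := by
  refine monotone_nat_of_le_succ fun n => ?_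
  rw [prefixWord_succ, wordS_append]
  exact wordS_mono _ (wordS_mem [ω n] (by simp)).1

lemma bddAbove_prefix (ω : ℕ → ℕ+) : BddAbove (range fun n => wordS (prefixWord ω n) 0) :=
  ⟨1, by rintro _ ⟨n, rfl⟩; exact (wordS_mem _ (by simp)).2⟩

lemma coding_cons (ω : ℕ → ℕ+) : coding ω = S (ω 0) (coding fun i => ω (i + 1)) := by
  unfold coding
  rw [(S_mono (ω 0)).map_ciSup_of_continuousAt (S_continuous _).continuousAt (bddAbove_prefix _)]
  rw [← (wordS_prefix_mono ω).ciSup_comp_tendsto_atTop_of_linearOrder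
    (Filter.tendsto_add_atTop_nat 1)]
  simp [prefixWord_succ', wordS]

lemma coding_mem (ω : ℕ → ℕ+) : coding ω ∈ Icc (0 : ℝ) 1 :=
  ⟨le_ciSup_of_le (bddAbove_prefix ω) 0 (wordS_mem _ (by simp)).1,
    ciSup_le fun n => (wordS_mem _ (by simp)).2⟩

lemma coding_prefix (ω : ℕ → ℕ+) (n : ℕ) :
    coding ω = wordS (prefixWord ω n) (coding fun i => ω (i + n)) := by
  induction n with
  | zero => simp [prefixWord, wordS]
  | succ n ih =>
    rw [prefixWord_succ, wordS_append, ih, coding_cons]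
    simp [wordS, add_comm, add_left_comm]

lemma abs_wordS_sub (ω : List ℕ+) (x y : ℝ) :
    |wordS ω x - wordS ω y| ≤ (1 / 3) ^ ω.length * |x - y| := by
  induction ω with
  | nil => simp [wordS]
  | cons j ω ih =>
    have h : S j (wordS ω x) - S j (wordS ω y) = 1 / 3 ^ (j : ℕ) * (wordS ω x - wordS ω y) := by
      unfold S; ring
    have h3 : (1 : ℝ) / 3 ^ (j : ℕ) ≤ 1 / 3 := by
      apply one_div_le_one_div_of_le (by norm_num)
      exact le_self_pow₀ (by norm_num) j.ne_zero
    simp only [wordS, Function.comp, List.length_cons]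
    rw [h, abs_mul, abs_of_nonneg (by positivity : (0 : ℝ) ≤ 1 / 3 ^ (j : ℕ)), pow_succ', mul_assoc]
    exact mul_le_mul h3 ih (abs_nonneg _) (by norm_num)

/-- The coding map is given by `{π(ω)} = ⋂ₙ S_{ω₁⋯ωₙ}([0, 1])`. -/
theorem iInter_J_prefixWord (ω : ℕ → ℕ+) : ⋂ n : ℕ, J (prefixWord ω n) = {coding ω} := by
  have hmem : ∀ n, coding ω ∈ J (prefixWord ω n) := fun n =>
    ⟨_, coding_mem _, (coding_prefix ω n).symm⟩
  refine Subset.antisymm (fun x hx => ?_) (by simpa using hmem)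
  rw [mem_iInter] at hx
  have hb : ∀ n : ℕ, |x - coding ω| ≤ (1 / 3 : ℝ) ^ n := by
    intro n
    obtain ⟨y, hy, rfl⟩ := hx n
    obtain ⟨z, hz, hz'⟩ := hmem n
    rw [← hz']
    refine (abs_wordS_sub _ y z).trans ?_
    have : |y - z| ≤ 1 := by rw [abs_le]; constructor <;> linarith [hy.1, hy.2, hz.1, hz.2]
    simpa [prefixWord] using mul_le_mul_of_nonneg_left this (by positivity : (0 : ℝ) ≤ (1 / 3) ^ n)
  have h0 : |x - coding ω| ≤ 0 := ge_of_tendsto'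
    (tendsto_pow_atTop_nhds_zero_of_lt_one (by norm_num) (by norm_num)) hb
  exact sub_eq_zero.1 (abs_nonpos_iff.1 h0)

lemma measurable_S_comp {Ω : Type*} [MeasurableSpace Ω] {a : Ω → ℕ+} {f : Ω → ℝ}
    (ha : Measurable a) (hf : Measurable f) : Measurable fun ω => S (a ω) (f ω) := by
  have h1 : Measurable fun ω => (1 : ℝ) / 3 ^ (a ω : ℕ) :=
    (measurable_from_top (f := fun j : ℕ+ => (1 : ℝ) / 3 ^ (j : ℕ))).comp ha
  have h2 : Measurable fun ω => (1 : ℝ) / 3 ^ ((a ω : ℕ) - 1) :=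
    (measurable_from_top (f := fun j : ℕ+ => (1 : ℝ) / 3 ^ ((j : ℕ) - 1))).comp ha
  exact ((h1.mul hf).add_const 1).sub h2

lemma measurable_coding : Measurable coding := by
  refine Measurable.iSup fun n => ?_
  induction n with
  | zero => simp [prefixWord]
  | succ n ih =>
    simp only [prefixWord_succ', wordS, Function.comp]
    exact measurable_S_comp (measurable_pi_apply 0)
      (ih.comp (measurable_pi_lambda _ fun i => measurable_pi_apply (i + 1)))

/-- The law of the coding map when the letters are independent with probabilities `p_j`. By
`isSelfSimilar_iff` below, it is the only Borel probability measure on the line with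
`P = ∑_j p_j P ∘ S_j⁻¹`. -/
def P : Measure ℝ := (Measure.infinitePi fun _ : ℕ => letterMeasure).map coding

instance : IsProbabilityMeasure P :=
  Measure.isProbabilityMeasure_map measurable_coding.aemeasurable

/-- Prepending a letter to an infinite word. -/
def consWord (j : ℕ+) (ω : ℕ → ℕ+) : ℕ → ℕ+
  | 0 => j
  | i + 1 => ω i

lemma measurable_consWord (j : ℕ+) : Measurable (consWord j) := by
  refine measurable_pi_lambda _ fun i => ?_
  cases i with
  | zero => exact measurable_const
  | succ i => exact measurable_pi_apply i

lemma consWord_preimage (j : ℕ+) (u : ℕ → Set ℕ+) (N : ℕ) :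
    consWord j ⁻¹' (Set.pi (Finset.range (N + 1)) u) =
      {_ω | j ∈ u 0} ∩ Set.pi (Finset.range N) fun i => u (i + 1) := by
  ext ω
  simp only [mem_preimage, Set.mem_pi, Finset.coe_range, mem_Iio, mem_inter_iff, mem_ofPred_eq]
  constructor
  · intro h
    exact ⟨h 0 (by omega), fun i hi => h (i + 1) (by omega)⟩
  · rintro ⟨h0, h⟩ i hi
    cases i with
    | zero => exact h0
    | succ i => exact h i (by omega)

lemma infinitePi_eq_sum :
    (Measure.infinitePi fun _ : ℕ => letterMeasure) =
      Measure.sum fun j : ℕ+ => ENNReal.ofReal (p j) •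
        (Measure.infinitePi fun _ : ℕ => letterMeasure).map (consWord j) := by
  classical
  symm
  refine Measure.eq_infinitePi _ fun s t ht => ?_
  obtain ⟨N, hN⟩ : ∃ N, s ⊆ Finset.range (N + 1) :=
    ⟨s.sup id, fun i hi => Finset.mem_range_succ_iff.2 (Finset.le_sup (f := id) hi)⟩
  set u : ℕ → Set ℕ+ := fun i => if i ∈ s then t i else univ with hu
  have hset : Set.pi (s : Set ℕ) t = Set.pi (Finset.range (N + 1)) u := by
    ext ω
    simp only [Set.mem_pi, hu]
    constructor
    · intro h i _
      by_cases hi : i ∈ s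
      · simpa [hi] using h i hi
      · simp [hi]
    · intro h i hi
      have := h i (hN hi)
      simpa [Finset.mem_coe.1 hi] using this
  have hprod : ∏ i ∈ s, letterMeasure (t i) = ∏ i ∈ Finset.range (N + 1), letterMeasure (u i) := by
    rw [← Finset.prod_subset hN (f := fun i => letterMeasure (u i))]
    · exact Finset.prod_congr rfl fun i hi => by simp [hu, hi]
    · intro i _ hi
      simp [hu, hi]
  have hm : MeasurableSet (Set.pi (Finset.range (N + 1) : Set ℕ) u) :=
    MeasurableSet.pi (Finset.countable_toSet _) fun _ _ => MeasurableSet.of_discrete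
  have h1 : letterMeasure (u 0) = ∑' j : ℕ+, ENNReal.ofReal (p j) * (u 0).indicator 1 j := by
    simp [letterMeasure, Measure.sum_apply]
  have hc : ∀ j : ℕ+, (Measure.infinitePi fun _ : ℕ => letterMeasure).map (consWord j)
      (Set.pi (Finset.range (N + 1) : Set ℕ) u) =
      (u 0).indicator 1 j * ∏ i ∈ Finset.range N, letterMeasure (u (i + 1)) := by
    intro j
    rw [Measure.map_apply (measurable_consWord j) hm, consWord_preimage]
    by_cases hj : j ∈ u 0
    · simp only [hj, ofPred_true, univ_inter, indicator_of_mem, Pi.one_apply, one_mul]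
      exact Measure.infinitePi_pi _ fun _ _ => MeasurableSet.of_discrete
    · simp [hj]
  rw [hset, hprod, Finset.prod_range_succ', Measure.sum_apply _ hm]
  simp only [Measure.smul_apply, smul_eq_mul, hc]
  simp only [← mul_assoc]
  rw [ENNReal.tsum_mul_right, h1, mul_comm]

/-- The measure `P` satisfies `P = ∑_j p_j P ∘ S_j⁻¹`. -/
theorem isSelfSimilar_P : IsSelfSimilar P := by
  unfold IsSelfSimilar
  conv_lhs => rw [P, infinitePi_eq_sum, Measure.map_sum measurable_coding.aemeasurable]
  congr 1
  ext1 j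
  rw [Measure.map_smul, Measure.map_map measurable_coding (measurable_consWord j), P,
    Measure.map_map (S_continuous j).measurable measurable_coding]
  congr 2
  ext1 ω
  exact coding_cons _

lemma charFun_eq {Q : Measure ℝ} [IsProbabilityMeasure Q] (hQ : IsSelfSimilar Q) (t : ℝ) :
    HasSum (fun j : ℕ+ => (p j : ℂ) *
      (Complex.exp ((t * (1 - 1 / 3 ^ ((j : ℕ) - 1)) : ℝ) * Complex.I) *
        charFun Q (t / 3 ^ (j : ℕ)))) (charFun Q t) := by
  have hf : Continuous fun x : ℝ => Complex.exp (t * x * Complex.I) := by fun_prop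
  have hi : Integrable (fun x : ℝ => Complex.exp (t * x * Complex.I)) Q := by
    refine Integrable.of_bound hf.aestronglyMeasurable 1 (ae_of_all _ fun x => ?_)
    rw [← Complex.ofReal_mul, Complex.norm_exp_ofReal_mul_I]
  have hi' := hi
  rw [hQ] at hi'
  have h := hasSum_integral_measure hi'
  rw [← hQ] at h
  rw [charFun_apply_real]
  refine Eq.mpr (congrArg (fun f => HasSum f _) (funext fun j => ?_)) h
  rw [integral_smul_measure, integral_map (S_continuous j).aemeasurable hf.aestronglyMeasurable,
    ENNReal.toReal_ofReal (p_pos j).le, charFun_apply_real, ← integral_const_mul,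
    Complex.real_smul]
  congr 2
  ext1 x
  rw [← Complex.exp_add]
  congr 1
  unfold S
  push_cast
  ring

/-- `P` is the only probability measure with `P = ∑_j p_j P ∘ S_j⁻¹`. -/
theorem isSelfSimilar_iff (Q : Measure ℝ) [IsProbabilityMeasure Q] : IsSelfSimilar Q ↔ Q = P := by
  refine ⟨fun hQ => ?_, fun h => h ▸ isSelfSimilar_P⟩
  have hp : HasSum p 1 := by
    have h := ENNReal.summable_toReal (f := fun j => ENNReal.ofReal (p j)) (by simp [tsum_ofReal_p])
    have h2 := ENNReal.tsum_toReal_eq (f := fun j => ENNReal.ofReal (p j)) (by simp)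
    simp only [ENNReal.toReal_ofReal (p_pos _).le, tsum_ofReal_p, ENNReal.toReal_one] at h h2
    rw [h2]
    exact h.hasSum
  set D : ℝ → ℂ := fun t => charFun Q t - charFun P t with hD
  have hstep : ∀ ε r : ℝ, (∀ t, |t| ≤ r → ‖D t‖ ≤ ε) → ∀ t, |t| ≤ 3 * r → ‖D t‖ ≤ ε := by
    intro ε r h t ht
    have hs := (charFun_eq hQ t).sub (charFun_eq isSelfSimilar_P t)
    have hb := hp.mul_right ε
    rw [one_mul] at hb
    refine hs.norm_le_of_bounded hb fun j => ?_
    rw [← mul_sub, ← mul_sub, norm_mul, norm_mul, Complex.norm_exp_ofReal_mul_I, one_mul,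
      Complex.norm_real, Real.norm_of_nonneg (p_pos j).le]
    refine mul_le_mul_of_nonneg_left (h _ ?_) (p_pos j).le
    rw [abs_div, abs_of_pos (by positivity : (0 : ℝ) < 3 ^ (j : ℕ)), div_le_iff₀ (by positivity)]
    have h3 : (3 : ℝ) ≤ 3 ^ (j : ℕ) := le_self_pow₀ (by norm_num) j.ne_zero
    have hr : 0 ≤ r := by linarith [abs_nonneg t]
    nlinarith
  have hcont : Continuous D := (continuous_charFun).sub continuous_charFun
  have hD0 : D 0 = 0 := by simp [hD]
  refine Measure.ext_of_charFun (funext fun t => sub_eq_zero.1 (norm_le_zero_iff.1 ?_))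
  change ‖D t‖ ≤ 0
  refine le_of_forall_pos_le_add fun ε hε => ?_
  rw [zero_add]
  obtain ⟨δ, hδ, hδ'⟩ := Metric.continuous_iff.1 hcont 0 ε hε
  have hn : ∀ n : ℕ, ∀ t, |t| ≤ 3 ^ n * (δ / 2) → ‖D t‖ ≤ ε := by
    intro n
    induction n with
    | zero =>
      intro t ht
      have := hδ' t (by rw [Real.dist_eq, sub_zero]; linarith)
      rw [hD0, dist_zero_right] at this
      exact this.le
    | succ n ih =>
      intro t ht
      refine hstep ε _ ih t ?_
      rw [pow_succ'] at ht
      linarith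
  obtain ⟨n, hn'⟩ := pow_unbounded_of_one_lt (|t| / (δ / 2)) (by norm_num : (1 : ℝ) < 3)
  refine hn n t ?_
  rw [div_lt_iff₀ (by positivity)] at hn'
  exact hn'.le

/-! ### Optimal sets of `n`-means -/

/-- The distortion error `V(α) = ∫ min_{a ∈ α} (x - a) ^ 2 dP(x)` of a nonempty finite set `α`. -/
def distortion (α : Set ℝ) : ℝ := ∫ x, ⨅ a : α, (x - (a : ℝ)) ^ 2 ∂P

/-- The `n`-th quantization error `V_n`, the infimum of the distortion errors of the nonempty sets
with at most `n` points, for `n ≥ 1`. -/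
def V (n : ℕ) : ℝ :=
  sInf {v | ∃ α : Set ℝ, α.Nonempty ∧ α.Finite ∧ α.ncard ≤ n ∧ v = distortion α}

/-- `α` is an optimal set of `n`-means: it has at most `n` points, and its distortion error is the
`n`-th quantization error. -/
def IsOptimal (n : ℕ) (α : Set ℝ) : Prop :=
  α.Nonempty ∧ α.Finite ∧ α.ncard ≤ n ∧ distortion α = V n

/-- `P` is carried by the unit interval. -/
lemma P_ae_mem : ∀ᵐ x ∂P, x ∈ Icc (0 : ℝ) 1 :=
  (ae_map_iff measurable_coding.aemeasurable measurableSet_Icc).2 (ae_of_all _ coding_mem)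

/-- The integral that defines the distortion error of a nonempty finite set converges. -/
lemma integrable_distortion {α : Set ℝ} (h : α.Nonempty) (hf : α.Finite) :
    Integrable (fun x => ⨅ a : α, (x - (a : ℝ)) ^ 2) P := by
  obtain ⟨a, ha⟩ := h
  have : Countable α := hf.countable
  have hbdd : ∀ x : ℝ, BddBelow (range fun a : α => (x - (a : ℝ)) ^ 2) := fun x =>
    ⟨0, by rintro _ ⟨b, rfl⟩; positivity⟩
  refine Integrable.of_bound (C := (1 + |a|) ^ 2)
    (Measurable.iInf fun b : α => (measurable_id.sub_const (b : ℝ)).pow_const 2).aestronglyMeasurable ?_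
  filter_upwards [P_ae_mem] with x hx
  have h0 : 0 ≤ ⨅ a : α, (x - (a : ℝ)) ^ 2 := Real.iInf_nonneg fun b => by positivity
  rw [Real.norm_of_nonneg h0]
  refine (ciInf_le (hbdd x) ⟨a, ha⟩).trans ?_
  have : |x - a| ≤ 1 + |a| := (abs_sub x a).trans (by rw [abs_of_nonneg hx.1]; linarith [hx.2])
  simpa using pow_le_pow_left₀ (abs_nonneg _) this 2

/-! ### The sets `α(k)` -/

/-- `a(ω) = E(X | X ∈ J_ω)`. -/
def a (ω : List ℕ+) : ℝ := ⨍ x in J ω, x ∂P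

/-- `a(ω, ∞) = E(X | X ∈ J_{(ω, ∞)})`. -/
def aInf (ω : List ℕ+) : ℝ := ⨍ x in JInf ω, x ∂P

/-- `α(k) = {a(ω) : p_ω = 1 / 2 ^ k} ∪ {a(ω, ∞) : p_ω = 1 / 2 ^ k}`. -/
def alpha (k : ℕ) : Set ℝ :=
  {x | ∃ ω : List ℕ+, wordP ω = 1 / 2 ^ k ∧ x = a ω} ∪
    {x | ∃ ω : List ℕ+, wordP ω = 1 / 2 ^ k ∧ x = aInf ω}

end CantorInf

end

/-! Since `S 1 = cL` and `S (j + 1) = cR ∘ S j`, with `p (j + 1) = p j / 2`, the letter `j` stands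
for `j - 1` right moves followed by a left move in the Cantor construction. Hence `P` is the
classical Cantor distribution (`P_apply_eq`), with mean `1 / 2` and variance `1 / 8`. Words of
weight `1 / 2 ^ k` correspond to the level `k` Cantor intervals whose last move is left; `a ω` is
the midpoint of such an interval, and `aInf ω` the midpoint of its right sibling. So `alpha k` is
the set of all level `k` midpoints (`alpha_eq_midpoints`), and `S j` carries the midpoints of level
`k - j` onto those of level `k` in `J [j]` (`preimage_S_midpoints`).

It remains to show `V (2 ^ k) = (1 / 9) ^ k / 8`. The midpoints give the upper bound. For the lower
bound, `dyadicBound k` is the line in `n` through the expected errors at `2 ^ k` and `2 ^ (k + 1)`;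
it is shown to bound the error of every set of `n` points (`dyadicBound_le_distortion`), by
induction on `k`. If no point of the set is nearest to points of both halves of the Cantor set, the
error splits, and `dyadicBound_succ` says that the lines add up exactly: the factor `1 / 18` is the
weight `1 / 2` times the squared ratio `1 / 9`. If some point serves both halves, its neighbours are
pushed away from the central gap, and explicit estimates show that the error exceeds all the lines
at once (`dyadicBound_le_distortion_of_gap`). -/

noncomputable section

namespace CantorInf

/-! ### The two similarities of the Cantor set -/

/-- The left similarity `x / 3` of the Cantor set. -/
def cL (x : ℝ) : ℝ := x / 3

/-- The right similarity `x / 3 + 2 / 3` of the Cantor set. -/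
def cR (x : ℝ) : ℝ := x / 3 + 2 / 3

lemma continuous_cL : Continuous cL := by unfold cL; fun_prop

lemma continuous_cR : Continuous cR := by unfold cR; fun_prop

lemma S_one : S 1 = cL := by
  ext x; simp [S, cL]; ring

lemma S_succ (j : ℕ+) : S (j + 1) = cR ∘ S j := by
  ext x
  have h := three_pow j
  simp only [S, cR, Function.comp, PNat.add_coe, PNat.one_coe, Nat.add_sub_cancel, pow_succ, h]
  field_simp
  ring

lemma p_succ (j : ℕ+) : p (j + 1) = 1 / 2 * p j := by
  simp [p, pow_succ, mul_comm]

lemma tsum_pnat_eq (f : ℕ+ → ENNReal) : ∑' j, f j = f 1 + ∑' j, f (j + 1) := by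
  rw [← Equiv.pnatEquivNat.symm.tsum_eq, tsum_eq_zero_add' ENNReal.summable,
    ← Equiv.pnatEquivNat.symm.tsum_eq (fun j => f (j + 1))]
  rfl

/-- The self-similarity operator of the infinite system. -/
def selfSum (Q : Measure ℝ) : Measure ℝ :=
  Measure.sum fun j : ℕ+ => ENNReal.ofReal (p j) • Q.map (S j)

lemma selfSum_apply (Q : Measure ℝ) {s : Set ℝ} (hs : MeasurableSet s) :
    selfSum Q s = ∑' j : ℕ+, ENNReal.ofReal (p j) * Q (S j ⁻¹' s) := by
  rw [selfSum, Measure.sum_apply _ hs]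
  simp [Measure.map_apply (S_continuous _).measurable hs]

lemma ofReal_half : ENNReal.ofReal (1 / 2) = 1 / 2 := by
  rw [ENNReal.ofReal_div_of_pos two_pos]; simp

/-- The terms of the series from `j = 2` on are half of the whole series pulled back by `cR`. -/
lemma selfSum_apply_eq (Q : Measure ℝ) {s : Set ℝ} (hs : MeasurableSet s) :
    selfSum Q s = 1 / 2 * Q (cL ⁻¹' s) + 1 / 2 * selfSum Q (cR ⁻¹' s) := by
  rw [selfSum_apply Q hs, selfSum_apply Q (continuous_cR.measurable hs), tsum_pnat_eq,
    ← ENNReal.tsum_mul_left, S_one]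
  congr 1
  · have : p 1 = 1 / 2 := by simp [p]
    rw [this, ofReal_half]
  · refine tsum_congr fun j => ?_
    rw [p_succ, S_succ, ENNReal.ofReal_mul (by norm_num), preimage_comp, mul_assoc, ofReal_half]

lemma selfSum_P : selfSum P = P := isSelfSimilar_P.symm

/-- `P` is the Cantor distribution: it is self-similar for the two maps `cL` and `cR`. -/
theorem P_apply_eq {s : Set ℝ} (hs : MeasurableSet s) :
    P s = 1 / 2 * P (cL ⁻¹' s) + 1 / 2 * P (cR ⁻¹' s) := by
  simpa [selfSum_P] using selfSum_apply_eq P hs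

theorem P_eq_add :
    P = (1 / 2 : ENNReal) • P.map cL + (1 / 2 : ENNReal) • P.map cR := by
  ext s hs
  rw [P_apply_eq hs]
  simp [Measure.map_apply continuous_cL.measurable hs, Measure.map_apply continuous_cR.measurable hs]

/-- The Cantor distribution is the only probability measure that is self-similar for `cL`, `cR`. -/
theorem eq_P_of_apply_eq (Q : Measure ℝ) [IsProbabilityMeasure Q]
    (hQ : ∀ s, MeasurableSet s → Q s = 1 / 2 * Q (cL ⁻¹' s) + 1 / 2 * Q (cR ⁻¹' s)) : Q = P := by
  rw [← isSelfSimilar_iff]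
  change Q = selfSum Q
  have huniv : selfSum Q univ = 1 := by
    rw [selfSum_apply Q MeasurableSet.univ]
    simp [tsum_ofReal_p]
  have : IsProbabilityMeasure (selfSum Q) := ⟨huniv⟩
  -- Both measures satisfy recursions with the same `cL` term, so their difference at `s` is half
  -- their difference at `cR ⁻¹' s`.
  have key : ∀ n : ℕ, ∀ s, MeasurableSet s → |Q.real s - (selfSum Q).real s| ≤ (1 / 2) ^ n := by
    intro n
    induction n with
    | zero =>
      intro s _
      rw [pow_zero, abs_le]
      constructor <;>
        linarith [measureReal_nonneg (μ := Q) (s := s), measureReal_nonneg (μ := selfSum Q) (s := s),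
          measureReal_le_one (μ := Q) (s := s), measureReal_le_one (μ := selfSum Q) (s := s)]
    | succ n ih =>
      intro s hs
      have h1 : Q.real s = 1 / 2 * Q.real (cL ⁻¹' s) + 1 / 2 * Q.real (cR ⁻¹' s) := by
        simp only [Measure.real]
        rw [hQ s hs, ENNReal.toReal_add (by finiteness) (by finiteness)]
        simp
      have h2 : (selfSum Q).real s =
          1 / 2 * Q.real (cL ⁻¹' s) + 1 / 2 * (selfSum Q).real (cR ⁻¹' s) := by
        simp only [Measure.real]
        rw [selfSum_apply_eq Q hs, ENNReal.toReal_add (by finiteness) (by finiteness)]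
        simp
      have h3 := abs_le.1 (ih _ (continuous_cR.measurable hs))
      rw [h1, h2, pow_succ, abs_le]
      constructor <;> linarith [h3.1, h3.2]
  ext s hs
  have h0 : |Q.real s - (selfSum Q).real s| ≤ 0 := ge_of_tendsto'
    (tendsto_pow_atTop_nhds_zero_of_lt_one (by norm_num) (by norm_num)) fun n => key n s hs
  exact (measureReal_eq_measureReal_iff).1 (sub_eq_zero.1 (abs_nonpos_iff.1 h0))

lemma measurable_reflect : Measurable fun x : ℝ => 1 - x := by fun_prop

/-- The Cantor distribution is symmetric about `1 / 2`. -/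
theorem map_reflect_P : P.map (fun x => 1 - x) = P := by
  have := Measure.isProbabilityMeasure_map (μ := P) measurable_reflect.aemeasurable
  refine eq_P_of_apply_eq _ fun s hs => ?_
  rw [Measure.map_apply measurable_reflect hs,
    Measure.map_apply measurable_reflect (continuous_cL.measurable hs),
    Measure.map_apply measurable_reflect (continuous_cR.measurable hs),
    P_apply_eq (measurable_reflect hs), add_comm]
  congr 3 <;> ext x <;> simp only [mem_preimage, cL, cR] <;>
    (refine iff_of_eq (congrArg (· ∈ s) ?_); ring)

/-! ### Integration against the Cantor distribution -/

lemma integrable_of_continuous {f : ℝ → ℝ} (hf : Continuous f) : Integrable f P := by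
  obtain ⟨C, hC⟩ := (isCompact_Icc (a := (0 : ℝ)) (b := 1)).exists_bound_of_continuousOn hf.continuousOn
  refine Integrable.of_bound hf.aestronglyMeasurable C ?_
  filter_upwards [P_ae_mem] with x hx using hC x hx

theorem integral_eq_add {f : ℝ → ℝ} (hf : Continuous f) :
    ∫ x, f x ∂P = 1 / 2 * ∫ x, f (cL x) ∂P + 1 / 2 * ∫ x, f (cR x) ∂P := by
  have hL : Integrable f (P.map cL) :=
    (integrable_map_measure hf.aestronglyMeasurable continuous_cL.aemeasurable).2
      (integrable_of_continuous (hf.comp continuous_cL))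
  have hR : Integrable f (P.map cR) :=
    (integrable_map_measure hf.aestronglyMeasurable continuous_cR.aemeasurable).2
      (integrable_of_continuous (hf.comp continuous_cR))
  conv_lhs => rw [P_eq_add]
  rw [integral_add_measure (hL.smul_measure (by simp)) (hR.smul_measure (by simp)),
    integral_smul_measure, integral_smul_measure,
    integral_map continuous_cL.aemeasurable hf.aestronglyMeasurable,
    integral_map continuous_cR.aemeasurable hf.aestronglyMeasurable]
  simp

lemma integral_reflect {f : ℝ → ℝ} (hf : Continuous f) :
    ∫ x, f (1 - x) ∂P = ∫ x, f x ∂P := by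
  conv_rhs => rw [← map_reflect_P]
  rw [integral_map measurable_reflect.aemeasurable hf.aestronglyMeasurable]

lemma integral_id_P : ∫ x, x ∂P = 1 / 2 := by
  have h := integral_reflect (f := fun x => x) continuous_id
  rw [integral_sub (integrable_const (1 : ℝ)) (integrable_of_continuous (f := fun x => x) continuous_id)] at h
  simp at h
  linarith

/-- The second moment stays a parameter so that `integral_sq_P` can solve the linear equation that
self-similarity imposes on it. -/
lemma integral_affine_sq_aux (q c d : ℝ) (hq : ∫ x, x ^ 2 ∂P = q) :
    ∫ x, (c * x + d) ^ 2 ∂P = c ^ 2 * q + c * d + d ^ 2 := by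
  have h : ∀ x : ℝ, (c * x + d) ^ 2 = c ^ 2 * x ^ 2 + 2 * c * d * x + d ^ 2 := fun x => by ring
  simp only [h]
  rw [integral_add (integrable_of_continuous (by fun_prop)) (integrable_const _),
    integral_add (integrable_of_continuous (by fun_prop)) (integrable_of_continuous (by fun_prop)),
    integral_const_mul, integral_const_mul, integral_id_P, hq]
  simp
  ring

lemma integral_sq_P : ∫ x, x ^ 2 ∂P = 3 / 8 := by
  have h := integral_eq_add (f := fun x => x ^ 2) (by fun_prop)
  have hL : ∀ x, cL x = 1 / 3 * x + 0 := fun x => by unfold cL; ring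
  have hR : ∀ x, cR x = 1 / 3 * x + 2 / 3 := fun x => by unfold cR; ring
  simp only [hL, hR] at h
  rw [integral_affine_sq_aux _ _ _ rfl, integral_affine_sq_aux _ _ _ rfl] at h
  linarith

/-- The second moments of the Cantor distribution, of mean `1 / 2` and variance `1 / 8`. -/
theorem integral_affine_sq (c d : ℝ) :
    ∫ x, (c * x + d) ^ 2 ∂P = c ^ 2 / 8 + (c / 2 + d) ^ 2 := by
  rw [integral_affine_sq_aux _ c d integral_sq_P]; ring

lemma integral_mono_of_Icc {f g : ℝ → ℝ} (hf : Continuous f) (hg : Continuous g)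
    (h : ∀ x ∈ Icc (0 : ℝ) 1, f x ≤ g x) : ∫ x, f x ∂P ≤ ∫ x, g x ∂P := by
  refine integral_mono_ae (integrable_of_continuous hf) (integrable_of_continuous hg) ?_
  filter_upwards [P_ae_mem] with x hx using h x hx

/-- The numerical lower bounds below all come from affine minorants of the distance, whose squares
have explicit integrals. -/
lemma affine_sq_le_integral {g : ℝ → ℝ} (hg : Continuous g) (c d : ℝ)
    (h : ∀ x ∈ Icc (0 : ℝ) 1, (c * x + d) ^ 2 ≤ g x) :
    c ^ 2 / 8 + (c / 2 + d) ^ 2 ≤ ∫ x, g x ∂P := by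
  rw [← integral_affine_sq]
  exact integral_mono_of_Icc (by fun_prop) hg h

/-! ### The squared distance to a finite set -/

/-- The squared distance `min_{a ∈ A} (x - a) ^ 2` to a finite set. -/
def sqDist (A : Finset ℝ) (x : ℝ) : ℝ := ⨅ a : (A : Set ℝ), (x - (a : ℝ)) ^ 2

lemma distortion_eq (A : Finset ℝ) : distortion (A : Set ℝ) = ∫ x, sqDist A x ∂P := rfl

lemma sqDist_le {A : Finset ℝ} {b : ℝ} (hb : b ∈ A) (x : ℝ) : sqDist A x ≤ (x - b) ^ 2 :=
  ciInf_le (f := fun a : (A : Set ℝ) => (x - (a : ℝ)) ^ 2)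
    ⟨0, by rintro _ ⟨b, rfl⟩; positivity⟩ ⟨b, hb⟩

lemma exists_sqDist_eq {A : Finset ℝ} (hA : A.Nonempty) (x : ℝ) :
    ∃ b ∈ A, sqDist A x = (x - b) ^ 2 := by
  have : Nonempty (A : Set ℝ) := hA.to_subtype
  obtain ⟨⟨b, hb⟩, h⟩ := exists_eq_ciInf_of_finite (f := fun a : (A : Set ℝ) => (x - (a : ℝ)) ^ 2)
  exact ⟨b, hb, h.symm⟩

lemma le_sqDist {A : Finset ℝ} (hA : A.Nonempty) {x c : ℝ} (h : ∀ b ∈ A, c ≤ (x - b) ^ 2) :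
    c ≤ sqDist A x := by
  obtain ⟨b, hb, hx⟩ := exists_sqDist_eq hA x
  exact hx ▸ h b hb

lemma sqDist_nonneg (A : Finset ℝ) (x : ℝ) : 0 ≤ sqDist A x :=
  Real.iInf_nonneg fun _ => sq_nonneg _

lemma continuous_sqDist {A : Finset ℝ} (hA : A.Nonempty) : Continuous (sqDist A) := by
  have h : sqDist A = fun x => A.inf' hA fun b => (x - b) ^ 2 := by
    ext x
    refine le_antisymm ((Finset.le_inf'_iff _ _).2 fun b hb => sqDist_le hb x) ?_
    exact le_sqDist hA fun b hb => Finset.inf'_le (fun b => (x - b) ^ 2) hb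
  rw [h]
  exact Continuous.finset_inf'_apply hA fun b _ => by fun_prop

/-- Used with `c = 1` for the reflection, `c = 9` for blowing up a half, and `c = 1 / 9` for `cL`
and `cR`. -/
lemma sqDist_image {A : Finset ℝ} (hA : A.Nonempty) {g : ℝ → ℝ} {c : ℝ}
    (hg : ∀ x y, (g x - g y) ^ 2 = c * (x - y) ^ 2) (hc : 0 ≤ c) (x : ℝ) :
    sqDist (A.image g) (g x) = c * sqDist A x := by
  refine le_antisymm ?_ (le_sqDist (hA.image g) fun b hb => ?_)
  · obtain ⟨b, hb, hx⟩ := exists_sqDist_eq hA x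
    rw [hx, ← hg]
    exact sqDist_le (Finset.mem_image_of_mem g hb) _
  · obtain ⟨d, hd, rfl⟩ := Finset.mem_image.1 hb
    rw [hg]
    exact mul_le_mul_of_nonneg_left (sqDist_le hd x) hc

lemma sqDist_anti {A B : Finset ℝ} (hA : A.Nonempty) (h : A ⊆ B) (x : ℝ) :
    sqDist B x ≤ sqDist A x :=
  le_sqDist hA fun _ hb => sqDist_le (h hb) x

/-- Reflection about `1 / 2` does not change the distortion error. -/
lemma distortion_reflect {A : Finset ℝ} (hA : A.Nonempty) :
    distortion ((A.image fun x => 1 - x : Finset ℝ) : Set ℝ) = distortion (A : Set ℝ) := by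
  rw [distortion_eq, distortion_eq, ← integral_reflect (continuous_sqDist (hA.image _))]
  refine integral_congr_ae (ae_of_all _ fun x => ?_)
  simpa using sqDist_image hA (g := fun x => 1 - x) (c := 1) (fun x y => by ring) zero_le_one x

/-! ### Lower bounds for the distortion error -/

lemma integral_quarters {g : ℝ → ℝ} (hg : Continuous g) :
    ∫ x, g x ∂P = 1 / 4 * (∫ x, g (x / 9) ∂P + ∫ x, g (x / 9 + 2 / 9) ∂P +
      ∫ x, g (x / 9 + 2 / 3) ∂P + ∫ x, g (x / 9 + 8 / 9) ∂P) := by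
  have hL := integral_eq_add (hg.comp continuous_cL)
  have hR := integral_eq_add (hg.comp continuous_cR)
  have h1 : ∀ x, cL (cL x) = x / 9 := fun x => by unfold cL; ring
  have h2 : ∀ x, cL (cR x) = x / 9 + 2 / 9 := fun x => by unfold cL cR; ring
  have h3 : ∀ x, cR (cL x) = x / 9 + 2 / 3 := fun x => by unfold cL cR; ring
  have h4 : ∀ x, cR (cR x) = x / 9 + 8 / 9 := fun x => by unfold cR; ring
  simp only [Function.comp, h1, h2, h3, h4] at hL hR
  rw [integral_eq_add hg, hL, hR]
  ring

/-- Integration of lower bounds by squares of affine functions over the two halves. -/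
lemma halves_le_integral {g : ℝ → ℝ} (hg : Continuous g) (c d c' d' : ℝ)
    (h : ∀ x ∈ Icc (0 : ℝ) (1 / 3), (c * x + d) ^ 2 ≤ g x)
    (h' : ∀ x ∈ Icc (2 / 3 : ℝ) 1, (c' * x + d') ^ 2 ≤ g x) :
    1 / 2 * (c ^ 2 / 72 + (c / 6 + d) ^ 2) + 1 / 2 * (c' ^ 2 / 72 + (5 * c' / 6 + d') ^ 2) ≤
      ∫ x, g x ∂P := by
  rw [integral_eq_add hg]
  have h1 := affine_sq_le_integral (hg.comp continuous_cL) (c / 3) d fun x hx => by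
    refine le_trans (le_of_eq ?_) (h (cL x) ?_)
    · unfold cL; ring
    · unfold cL; constructor <;> linarith [hx.1, hx.2]
  have h2 := affine_sq_le_integral (hg.comp continuous_cR) (c' / 3) (2 / 3 * c' + d') fun x hx => by
    refine le_trans (le_of_eq ?_) (h' (cR x) ?_)
    · unfold cR; ring
    · unfold cR; constructor <;> linarith [hx.1, hx.2]
  simp only [Function.comp] at h1 h2
  linarith

/-- Integration of lower bounds by squares of affine functions over the two left quarters and the
right half. -/
lemma pieces_le_integral {g : ℝ → ℝ} (hg : Continuous g) (c₁ d₁ c₂ d₂ c₃ d₃ : ℝ)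
    (h₁ : ∀ x ∈ Icc (0 : ℝ) (1 / 9), (c₁ * x + d₁) ^ 2 ≤ g x)
    (h₂ : ∀ x ∈ Icc (2 / 9 : ℝ) (1 / 3), (c₂ * x + d₂) ^ 2 ≤ g x)
    (h₃ : ∀ x ∈ Icc (2 / 3 : ℝ) 1, (c₃ * x + d₃) ^ 2 ≤ g x) :
    1 / 4 * (c₁ ^ 2 / 648 + (c₁ / 18 + d₁) ^ 2) + 1 / 4 * (c₂ ^ 2 / 648 + (5 * c₂ / 18 + d₂) ^ 2) +
      1 / 2 * (c₃ ^ 2 / 72 + (5 * c₃ / 6 + d₃) ^ 2) ≤ ∫ x, g x ∂P := by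
  rw [integral_eq_add hg]
  have h1 := halves_le_integral (hg.comp continuous_cL) (c₁ / 3) d₁ (c₂ / 3) d₂
    (fun x hx => by
      refine le_trans (le_of_eq ?_) (h₁ (cL x) ?_)
      · unfold cL; ring
      · unfold cL; constructor <;> linarith [hx.1, hx.2])
    (fun x hx => by
      refine le_trans (le_of_eq ?_) (h₂ (cL x) ?_)
      · unfold cL; ring
      · unfold cL; constructor <;> linarith [hx.1, hx.2])
  have h2 := affine_sq_le_integral (hg.comp continuous_cR) (c₃ / 3) (2 / 3 * c₃ + d₃) fun x hx => by
    refine le_trans (le_of_eq ?_) (h₃ (cR x) ?_)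
    · unfold cR; ring
    · unfold cR; constructor <;> linarith [hx.1, hx.2]
  simp only [Function.comp] at h1 h2
  linarith

/-- The cost of two points, one of which is at most `-1 / 2` and the other at least `1 / 2`. -/
lemma two_points_far {g : ℝ → ℝ} (hg : Continuous g) {u : ℝ} (hu : 1 / 2 ≤ u)
    (h : ∀ x ∈ Icc (0 : ℝ) 1, (x + 1 / 2) ^ 2 ≤ g x ∨ (x - u) ^ 2 ≤ g x) :
    91 / 1000 ≤ ∫ x, g x ∂P := by
  -- A point `u ≤ 5 / 8` is far from the right half; a point `u ≥ 5 / 8` leaves the two left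
  -- quarters expensive.
  rcases le_total u (5 / 8) with hu' | hu'
  · refine le_trans ?_ (halves_le_integral hg (-1) (1 / 2) 1 (-(5 / 8)) ?_ ?_)
    · norm_num
    · rintro x ⟨hx0, hx1⟩
      rcases h x ⟨hx0, by linarith⟩ with h | h <;> nlinarith
    · rintro x ⟨hx0, hx1⟩
      rcases h x ⟨by linarith, hx1⟩ with h | h <;> nlinarith
  · refine le_trans ?_ (pieces_le_integral hg 0 (1 / 2) (-1) (5 / 8) 0 0 ?_ ?_ ?_)
    · norm_num
    · rintro x ⟨hx0, hx1⟩
      rcases h x ⟨hx0, by linarith⟩ with h | h <;> nlinarith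
    · rintro x ⟨hx0, hx1⟩
      rcases h x ⟨by linarith, by linarith⟩ with h | h <;> nlinarith
    · rintro x ⟨hx0, hx1⟩
      rcases h x ⟨by linarith, hx1⟩ with h | h <;> nlinarith [sq_nonneg (x - u)]

/-- The cost of two points, one of which is at most `-3 / 10` and the other at least `3 / 10`. -/
lemma two_points_near {g : ℝ → ℝ} (hg : Continuous g) {u : ℝ} (hu : 3 / 10 ≤ u)
    (h : ∀ x ∈ Icc (0 : ℝ) 1, (x + 3 / 10) ^ 2 ≤ g x ∨ (x - u) ^ 2 ≤ g x) :
    49 / 1000 ≤ ∫ x, g x ∂P := by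
  have h0 : ∀ x ∈ Icc (0 : ℝ) 1, 0 ≤ g x := fun x hx => by
    rcases h x hx with h | h <;> exact le_trans (sq_nonneg _) h
  rcases le_total u (3 / 5) with hu' | hu'
  · refine le_trans ?_ (pieces_le_integral hg (-1) (3 / 10) 0 0 1 (-(3 / 5)) ?_ ?_ ?_)
    · norm_num
    · rintro x ⟨hx0, hx1⟩
      rcases h x ⟨hx0, by linarith⟩ with h | h <;> nlinarith
    · rintro x ⟨hx0, hx1⟩
      simpa using h0 x ⟨by linarith, by linarith⟩
    · rintro x ⟨hx0, hx1⟩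
      rcases h x ⟨by linarith, hx1⟩ with h | h <;> nlinarith
  · refine le_trans ?_ (pieces_le_integral hg 1 (3 / 10) (-1) (3 / 5) 0 0 ?_ ?_ ?_)
    · norm_num
    · rintro x ⟨hx0, hx1⟩
      rcases h x ⟨hx0, by linarith⟩ with h | h <;> nlinarith
    · rintro x ⟨hx0, hx1⟩
      rcases h x ⟨by linarith, by linarith⟩ with h | h <;> nlinarith
    · rintro x ⟨hx0, hx1⟩
      simpa using h0 x ⟨by linarith, by linarith⟩

/-! ### The cost of a point that serves both halves of the Cantor set -/

section Gap

variable {A : Finset ℝ}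

/-- The quarter `[2 / 3, 7 / 9]` alone suffices: there the distance to the set is at least `5 / 6 -
x`. -/
lemma distortion_gap_of_four (hA : A.Nonempty) (h : ∀ c ∈ A, c ≤ 1 / 2 ∨ 5 / 6 ≤ c) :
    1 / 648 ≤ distortion (A : Set ℝ) := by
  rw [distortion_eq, integral_quarters (continuous_sqDist hA)]
  have hc := continuous_sqDist hA
  have h1 := affine_sq_le_integral (g := fun x => sqDist A (x / 9 + 2 / 3)) (by fun_prop)
    (-(1 / 9)) (1 / 6) fun x ⟨hx0, hx1⟩ => le_sqDist hA fun c hcA => by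
      rcases h c hcA with h | h <;> nlinarith
  have h2 : ∀ d e : ℝ, 0 ≤ ∫ x, sqDist A (x / d + e) ∂P := fun d e =>
    integral_nonneg fun x => sqDist_nonneg _ _
  have h3 : 0 ≤ ∫ x, sqDist A (x / 9) ∂P := integral_nonneg fun x => sqDist_nonneg _ _
  have h4 := h2 9 (2 / 9)
  have h5 := h2 9 (8 / 9)
  norm_num at h1
  linarith

/-- The cost of the left half of the Cantor set if no point lies to the left of `1 / 3`. -/
lemma distortion_gap_of_left (hA : A.Nonempty) (h : ∀ c ∈ A, 1 / 3 ≤ c) :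
    1 / 48 ≤ distortion (A : Set ℝ) := by
  rw [distortion_eq]
  refine le_trans ?_ (halves_le_integral (continuous_sqDist hA) (-1) (1 / 3) 0 0 ?_ ?_)
  · norm_num
  · exact fun x ⟨hx0, hx1⟩ => le_sqDist hA fun c hc => by nlinarith [h c hc]
  · exact fun x _ => by simpa using sqDist_nonneg A x

/-- On the right half `x - 1 / 3 ≥ 1 / 3 ≥ 1 - x`, so the distance is at least `1 - x`. -/
lemma distortion_gap_of_right (hA : A.Nonempty) (h : ∀ c ∈ A, c ≤ 1 / 3 ∨ 1 ≤ c) :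
    1 / 48 ≤ distortion (A : Set ℝ) := by
  rw [distortion_eq]
  refine le_trans ?_ (halves_le_integral (continuous_sqDist hA) 0 0 (-1) 1 ?_ ?_)
  · norm_num
  · exact fun x _ => by simpa using sqDist_nonneg A x
  · exact fun x ⟨hx0, hx1⟩ => le_sqDist hA fun c hc => by rcases h c hc with h | h <;> nlinarith

lemma distortion_gap_of_right_half (hA : A.Nonempty) (h : ∀ c ∈ A, c ≤ 1 / 2) :
    1 / 48 ≤ distortion (A : Set ℝ) := by
  rw [distortion_eq]
  refine le_trans ?_ (halves_le_integral (continuous_sqDist hA) 0 0 1 (-(1 / 2)) ?_ ?_)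
  · norm_num
  · exact fun x _ => by simpa using sqDist_nonneg A x
  · exact fun x ⟨hx0, hx1⟩ => le_sqDist hA fun c hc => by nlinarith [h c hc]

/-- The tightest case: the target is the value at `3` of the line of level `1`, and both halves may
have to contribute. -/
lemma distortion_gap_of_three {b c d : ℝ} (hb : 1 / 3 ≤ b) (hb' : b ≤ 1 / 2) (hc : c ≤ 2 / 3 - b)
    (hd : 4 / 3 - b ≤ d) : 10 / 1296 ≤ distortion (({c, b, d} : Finset ℝ) : Set ℝ) := by
  have hA : ({c, b, d} : Finset ℝ).Nonempty := by simp
  have hcont := continuous_sqDist hA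
  rw [distortion_eq, integral_eq_add hcont]
  have hcases : ∀ x, sqDist {c, b, d} x = (x - c) ^ 2 ∨ sqDist {c, b, d} x = (x - b) ^ 2 ∨
      sqDist {c, b, d} x = (x - d) ^ 2 := fun x => by
    obtain ⟨e, he, h⟩ := exists_sqDist_eq hA x
    simp only [Finset.mem_insert, Finset.mem_singleton] at he
    rcases he with rfl | rfl | rfl <;> simp [h]
  have hL : 0 ≤ ∫ x, sqDist {c, b, d} (cL x) ∂P := integral_nonneg fun x => sqDist_nonneg _ _
  -- If `b ≤ 13 / 30` then `d ≥ 9 / 10`, and the quarter `[2 / 3, 7 / 9]`, at distance at least `9 /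
  -- 10 - x`, is enough.
  rcases le_total b (13 / 30) with hb'' | hb''
  · have h := halves_le_integral (hcont.comp continuous_cR) (-(1 / 3)) (7 / 30) 0 0
      (fun x ⟨hx0, hx1⟩ => by
        simp only [Function.comp, cR]
        rcases hcases (x / 3 + 2 / 3) with h | h | h <;> rw [h] <;> nlinarith)
      (fun x _ => by simpa using sqDist_nonneg _ _)
    simp only [Function.comp] at h
    norm_num at h
    linarith
  -- Blown up by `3`, the right half sees `b` at `3 * b - 2 ≤ -1 / 2`; the left half, also
  -- reflected, sees `b` at `1 - 3 * b ≤ -3 / 10`. The total `(91 + 49) / 18000` is just above `10 /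
  -- 1296`.
  · have h1 := two_points_far (g := fun x => 9 * sqDist {c, b, d} (cR x)) (u := 3 * d - 2)
      (continuous_const.mul (hcont.comp continuous_cR)) (by linarith) fun x ⟨hx0, hx1⟩ => by
        simp only [cR]
        rcases hcases (x / 3 + 2 / 3) with h | h | h <;> rw [h]
        · left; nlinarith
        · left; nlinarith
        · right; nlinarith
    have h2 := two_points_near (g := fun x => 9 * sqDist {c, b, d} (cL (1 - x))) (u := 1 - 3 * c)
      (continuous_const.mul (hcont.comp (continuous_cL.comp (by fun_prop)))) (by linarith)
      fun x ⟨hx0, hx1⟩ => by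
        simp only [cL]
        rcases hcases ((1 - x) / 3) with h | h | h <;> rw [h]
        · right; nlinarith
        · left; nlinarith
        · left; nlinarith
    rw [integral_const_mul] at h1 h2
    rw [integral_reflect (f := fun x => sqDist {c, b, d} (cL x)) (hcont.comp continuous_cL)] at h2
    linarith

end Gap

/-- The linear minorants of the quantization errors, one for each dyadic level. -/
def dyadicBound (k n : ℕ) : ℝ := (1 / 18) ^ k / 72 * (17 * 2 ^ k - 8 * n)

lemma dyadicBound_succ (k m n : ℕ) :
    dyadicBound (k + 1) (m + n) = 1 / 18 * (dyadicBound k m + dyadicBound k n) := by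
  unfold dyadicBound
  push_cast
  ring

lemma dyadicBound_anti (k : ℕ) {m n : ℕ} (h : m ≤ n) : dyadicBound k n ≤ dyadicBound k m := by
  unfold dyadicBound
  have : (m : ℝ) ≤ n := by exact_mod_cast h
  gcongr

/-- At `n = 2 ^ k` the line of level `k` takes the value of the error of the midpoints, so the lower
bound is sharp there. -/
lemma dyadicBound_two_pow (k : ℕ) : dyadicBound k (2 ^ k) = (1 / 9) ^ k / 8 := by
  unfold dyadicBound
  have : (1 / 9 : ℝ) ^ k = (1 / 18) ^ k * 2 ^ k := by rw [← mul_pow]; norm_num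
  rw [this]
  push_cast
  ring

lemma dyadicBound_le (k n : ℕ) : dyadicBound k n ≤ 17 / 72 * (1 / 9) ^ k := by
  unfold dyadicBound
  have : (1 / 9 : ℝ) ^ k = (1 / 18) ^ k * 2 ^ k := by rw [← mul_pow]; norm_num
  rw [this]
  have : 0 ≤ (1 / 18 : ℝ) ^ k * n := by positivity
  linarith

/-- Disposes of all large levels at once, so that suprema over `k` at a fixed small `n` reduce to
finitely many numerical checks. -/
lemma dyadicBound_le_of_le {m k : ℕ} (h : m ≤ k) (n : ℕ) :
    dyadicBound k n ≤ 17 / 72 * (1 / 9) ^ m := by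
  refine (dyadicBound_le k n).trans ?_
  have := pow_le_pow_of_le_one (by norm_num : (0 : ℝ) ≤ 1 / 9) (by norm_num) h
  linarith

lemma dyadicBound_one (k : ℕ) : dyadicBound k 1 ≤ 1 / 8 := by
  rcases k with _ | k
  · norm_num [dyadicBound]
  · refine (dyadicBound_le_of_le (m := 1) (by omega) _).trans (by norm_num)

lemma dyadicBound_two (k : ℕ) : dyadicBound k 2 ≤ 1 / 72 := by
  rcases k with _ | _ | k
  · norm_num [dyadicBound]
  · norm_num [dyadicBound]
  · refine (dyadicBound_le_of_le (m := 2) (by omega) _).trans (by norm_num)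

lemma dyadicBound_three (k : ℕ) : dyadicBound k 3 ≤ 10 / 1296 := by
  rcases k with _ | _ | k
  · norm_num [dyadicBound]
  · norm_num [dyadicBound]
  · refine (dyadicBound_le_of_le (m := 2) (by omega) _).trans (by norm_num)

lemma dyadicBound_four (k : ℕ) {n : ℕ} (hn : 4 ≤ n) : dyadicBound k n ≤ 1 / 648 := by
  refine (dyadicBound_anti k hn).trans ?_
  rcases k with _ | _ | _ | k
  · norm_num [dyadicBound]
  · norm_num [dyadicBound]
  · norm_num [dyadicBound]
  · refine (dyadicBound_le_of_le (m := 3) (by omega) _).trans (by norm_num)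

lemma dyadicBound_le_of_two_le (k : ℕ) {n : ℕ} (hn : 2 ≤ n) : dyadicBound k n ≤ 1 / 72 :=
  (dyadicBound_anti k hn).trans (dyadicBound_two k)

/-- The lower bound if one point `b ≤ 1 / 2` of `A` serves both halves of the Cantor set. -/
lemma dyadicBound_le_distortion_of_gap {A : Finset ℝ} {b : ℝ} (hbA : b ∈ A) (hb : b ≤ 1 / 2)
    (hA2 : 2 ≤ A.card)
    (h : ∀ c ∈ A, c = b ∨ (c < b ∧ c ≤ 2 / 3 - b) ∨ 4 / 3 - b ≤ c) (k : ℕ) :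
    dyadicBound k A.card ≤ distortion (A : Set ℝ) := by
  have hA : A.Nonempty := ⟨b, hbA⟩
  -- From four points on, the target is so small that `b ≤ 1 / 2` and `4 / 3 - b ≥ 5 / 6` suffice;
  -- for two or three points the positions matter.
  rcases Nat.lt_or_ge A.card 4 with h4 | h4
  swap
  · refine (dyadicBound_four k h4).trans (distortion_gap_of_four hA fun c hc => ?_)
    rcases h c hc with rfl | ⟨h, _⟩ | h
    · exact Or.inl hb
    · left; linarith
    · right; linarith
  have h72 := dyadicBound_le_of_two_le k hA2
  by_cases hright : ∀ c ∈ A, c ≤ b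
  · exact h72.trans (le_trans (by norm_num) (distortion_gap_of_right_half hA fun c hc =>
      (hright c hc).trans hb))
  rcases le_or_gt b (1 / 3) with hb3 | hb3
  · refine h72.trans (le_trans (by norm_num) (distortion_gap_of_right hA fun c hc => ?_))
    rcases h c hc with rfl | ⟨h, _⟩ | h
    · exact Or.inl hb3
    · left; linarith
    · right; linarith
  by_cases hleft : ∀ c ∈ A, b ≤ c
  · exact h72.trans (le_trans (by norm_num) (distortion_gap_of_left hA fun c hc =>
      hb3.le.trans (hleft c hc)))
  push Not at hright hleft
  obtain ⟨d, hd, hbd⟩ := hright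
  obtain ⟨c, hc, hcb⟩ := hleft
  have hsub : ({c, b, d} : Finset ℝ) ⊆ A := by
    intro x hx
    simp only [Finset.mem_insert, Finset.mem_singleton] at hx
    rcases hx with rfl | rfl | rfl <;> assumption
  have hcard : ({c, b, d} : Finset ℝ).card = 3 :=
    Finset.card_eq_three.2 ⟨c, b, d, hcb.ne, (hcb.trans hbd).ne, hbd.ne, rfl⟩
  -- With neighbours on both sides of `b` and fewer than four points, the set is exactly `{c, b,
  -- d}`.
  have hAeq : ({c, b, d} : Finset ℝ) = A := Finset.eq_of_subset_of_card_le hsub (by omega)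
  have hc' : c ≤ 2 / 3 - b := by
    rcases h c hc with h | ⟨_, h⟩ | h <;> linarith
  have hd' : 4 / 3 - b ≤ d := by
    rcases h d hd with h | ⟨_, h⟩ | h <;> linarith
  rw [← hAeq, hcard]
  exact (dyadicBound_three k).trans (distortion_gap_of_three hb3.le hb hc' hd')

/-- The points of `A` that are nearest to some point of the set `T`. -/
def nearest (A : Finset ℝ) (T : Set ℝ) : Finset ℝ := by
  classical exact A.filter fun b => ∃ x ∈ T, ∀ c ∈ A, (x - b) ^ 2 ≤ (x - c) ^ 2

lemma mem_nearest {A : Finset ℝ} {T : Set ℝ} {b : ℝ} :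
    b ∈ nearest A T ↔ b ∈ A ∧ ∃ x ∈ T, ∀ c ∈ A, (x - b) ^ 2 ≤ (x - c) ^ 2 := by
  simp [nearest]

lemma nearest_subset (A : Finset ℝ) (T : Set ℝ) : nearest A T ⊆ A :=
  fun _ hb => (mem_nearest.1 hb).1

lemma sqDist_nearest {A : Finset ℝ} (hA : A.Nonempty) {T : Set ℝ} {x : ℝ} (hx : x ∈ T) :
    (nearest A T).Nonempty ∧ sqDist (nearest A T) x ≤ sqDist A x := by
  obtain ⟨b, hb, h⟩ := exists_sqDist_eq hA x
  have hmem : b ∈ nearest A T := mem_nearest.2 ⟨hb, x, hx, fun c hc => h ▸ sqDist_le hc x⟩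
  exact ⟨⟨b, hmem⟩, h ▸ sqDist_le hmem x⟩

lemma two_mul_le_add {x b c : ℝ} (hbc : b < c) (h : (x - b) ^ 2 ≤ (x - c) ^ 2) :
    2 * x ≤ b + c := by
  by_contra! h'
  nlinarith

lemma add_le_two_mul {x b c : ℝ} (hbc : b < c) (h : (x - c) ^ 2 ≤ (x - b) ^ 2) :
    b + c ≤ 2 * x := by
  by_contra! h'
  nlinarith

/-- Splitting the distortion error over the two halves of the Cantor set. -/
lemma le_distortion_of_nearest {A : Finset ℝ} (hA : A.Nonempty) {c₁ c₂ : ℝ}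
    (h₁ : ∀ B : Finset ℝ, B.Nonempty → B.card = (nearest A (Icc 0 (1 / 3))).card →
      c₁ ≤ distortion (B : Set ℝ))
    (h₂ : ∀ B : Finset ℝ, B.Nonempty → B.card = (nearest A (Icc (2 / 3) 1)).card →
      c₂ ≤ distortion (B : Set ℝ)) :
    1 / 18 * (c₁ + c₂) ≤ distortion (A : Set ℝ) := by
  set A₁ := nearest A (Icc 0 (1 / 3)) with hA₁
  set A₂ := nearest A (Icc (2 / 3) 1) with hA₂
  have hn₁ : A₁.Nonempty := (sqDist_nearest hA (x := 0) (by norm_num)).1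
  have hn₂ : A₂.Nonempty := (sqDist_nearest hA (x := 1) (by norm_num)).1
  have h1 := h₁ (A₁.image fun x => 3 * x) (hn₁.image _)
    (Finset.card_image_of_injective _ fun x y h => by simpa using h)
  have h2 := h₂ (A₂.image fun x => 3 * x - 2) (hn₂.image _)
    (Finset.card_image_of_injective _ fun x y h => by simpa using h)
  rw [distortion_eq] at h1 h2 ⊢
  rw [integral_eq_add (continuous_sqDist hA)]
  have h1' : ∫ x, 1 / 9 * sqDist (A₁.image fun x => 3 * x) x ∂P ≤ ∫ x, sqDist A (cL x) ∂P := by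
    refine integral_mono_of_Icc (continuous_const.mul (continuous_sqDist (hn₁.image _)))
      ((continuous_sqDist hA).comp continuous_cL) fun x hx => ?_
    have h := sqDist_image hn₁ (g := fun x => 3 * x) (c := 9) (fun x y => by ring) (by norm_num)
      (cL x)
    have hx' : cL x ∈ Icc (0 : ℝ) (1 / 3) := by
      unfold cL; constructor <;> linarith [hx.1, hx.2]
    have hle := (sqDist_nearest hA hx').2
    have h3 : 3 * cL x = x := by unfold cL; ring
    simp only [h3] at h
    rw [h]
    linarith
  have h2' : ∫ x, 1 / 9 * sqDist (A₂.image fun x => 3 * x - 2) x ∂P ≤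
      ∫ x, sqDist A (cR x) ∂P := by
    refine integral_mono_of_Icc (continuous_const.mul (continuous_sqDist (hn₂.image _)))
      ((continuous_sqDist hA).comp continuous_cR) fun x hx => ?_
    have h := sqDist_image hn₂ (g := fun x => 3 * x - 2) (c := 9) (fun x y => by ring)
      (by norm_num) (cR x)
    have hx' : cR x ∈ Icc (2 / 3 : ℝ) 1 := by
      unfold cR; constructor <;> linarith [hx.1, hx.2]
    have hle := (sqDist_nearest hA hx').2
    have h3 : 3 * cR x - 2 = x := by unfold cR; ring
    simp only [h3] at h
    rw [h]
    linarith
  rw [integral_const_mul] at h1' h2'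
  linarith

lemma distortion_of_card_one {A : Finset ℝ} (hA : A.card = 1) :
    1 / 8 ≤ distortion (A : Set ℝ) := by
  obtain ⟨b, rfl⟩ := Finset.card_eq_one.1 hA
  rw [distortion_eq]
  have h := affine_sq_le_integral (continuous_sqDist (Finset.singleton_nonempty b)) 1 (-b)
    fun x _ => le_sqDist (Finset.singleton_nonempty b) fun c hc => by
      rw [Finset.mem_singleton.1 hc, one_mul, sub_eq_add_neg]
  nlinarith [sq_nonneg (1 / 2 + -b)]

/-- If `b` is nearest to some `x ≤ 1 / 3`, every `c < b` has `b + c ≤ 2 * x ≤ 2 / 3`; symmetrically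
every `c > b` has `b + c ≥ 4 / 3`. Reflection reduces to `b ≤ 1 / 2`. -/
lemma dyadicBound_le_distortion_of_inter {A : Finset ℝ} (hA2 : 2 ≤ A.card) {b : ℝ}
    (h₁ : b ∈ nearest A (Icc 0 (1 / 3))) (h₂ : b ∈ nearest A (Icc (2 / 3) 1)) (k : ℕ) :
    dyadicBound k A.card ≤ distortion (A : Set ℝ) := by
  obtain ⟨hb, x, hx, hxb⟩ := mem_nearest.1 h₁
  obtain ⟨-, y, hy, hyb⟩ := mem_nearest.1 h₂
  have key : ∀ c ∈ A, c = b ∨ (c < b ∧ c ≤ 2 / 3 - b) ∨ (b < c ∧ 4 / 3 - b ≤ c) := by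
    intro c hc
    rcases lt_trichotomy c b with h | h | h
    · exact Or.inr (Or.inl ⟨h, by linarith [add_le_two_mul h (hxb c hc), hx.2]⟩)
    · exact Or.inl h
    · exact Or.inr (Or.inr ⟨h, by linarith [two_mul_le_add h (hyb c hc), hy.1]⟩)
  rcases le_total b (1 / 2) with hb2 | hb2
  · exact dyadicBound_le_distortion_of_gap hb hb2 hA2
      (fun c hc => (key c hc).imp_right (Or.imp_right And.right)) k
  · have hcard : (A.image fun x => 1 - x).card = A.card :=
      Finset.card_image_of_injective _ fun x y h => by simpa using h
    rw [← distortion_reflect ⟨b, hb⟩, ← hcard]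
    refine dyadicBound_le_distortion_of_gap (b := 1 - b) (Finset.mem_image_of_mem _ hb)
      (by linarith) (hcard ▸ hA2) (fun c hc => ?_) k
    obtain ⟨d, hd, rfl⟩ := Finset.mem_image.1 hc
    rcases key d hd with rfl | ⟨h, h'⟩ | ⟨h, h'⟩
    · exact Or.inl rfl
    · exact Or.inr (Or.inr (by linarith))
    · exact Or.inr (Or.inl ⟨by linarith, by linarith⟩)

/-- The lower bounds for the distortion error of a finite set. -/
theorem dyadicBound_le_distortion (k : ℕ) {A : Finset ℝ} (hA : A.Nonempty) :
    dyadicBound k A.card ≤ distortion (A : Set ℝ) := by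
  induction k generalizing A with
  | zero =>
    rcases Nat.lt_or_ge A.card 2 with h2 | h2
    · have h1 : A.card = 1 := by have := hA.card_pos; omega
      rw [h1]
      exact (dyadicBound_one 0).trans (distortion_of_card_one h1)
    rcases (nearest A (Icc 0 (1 / 3)) ∩ nearest A (Icc (2 / 3) 1)).eq_empty_or_nonempty with h | ⟨b, h⟩
    swap
    · rw [Finset.mem_inter] at h
      exact dyadicBound_le_distortion_of_inter h2 h.1 h.2 0
    rcases Nat.lt_or_ge A.card 3 with h3 | h3
    swap
    · refine le_trans ?_ (integral_nonneg fun x => sqDist_nonneg A x)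
      refine (dyadicBound_anti 0 h3).trans ?_
      -- The line of level `0` is `(17 - 8 * n) / 72`, already negative at `n = 3`.
      norm_num [dyadicBound]
    have hn₁ := (sqDist_nearest hA (x := 0) (T := Icc 0 (1 / 3)) (by norm_num)).1.card_pos
    have hn₂ := (sqDist_nearest hA (x := 1) (T := Icc (2 / 3) 1) (by norm_num)).1.card_pos
    have hsum := Finset.card_le_card (Finset.union_subset
      (nearest_subset A (Icc 0 (1 / 3)))
      (nearest_subset A (Icc (2 / 3) 1)))
    rw [Finset.card_union_of_disjoint (Finset.disjoint_iff_inter_eq_empty.2 h)] at hsum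
    refine (dyadicBound_le_of_two_le 0 h2).trans (le_trans ?_ (le_distortion_of_nearest hA
      (c₁ := 1 / 8) (c₂ := 1 / 8) (fun B _ hB => distortion_of_card_one (by omega))
      (fun B _ hB => distortion_of_card_one (by omega))))
    norm_num
  | succ k ih =>
    rcases Nat.lt_or_ge A.card 2 with h2 | h2
    · have h1 : A.card = 1 := by have := hA.card_pos; omega
      rw [h1]
      exact (dyadicBound_one _).trans (distortion_of_card_one h1)
    rcases (nearest A (Icc 0 (1 / 3)) ∩ nearest A (Icc (2 / 3) 1)).eq_empty_or_nonempty with h | ⟨b, h⟩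
    swap
    · rw [Finset.mem_inter] at h
      exact dyadicBound_le_distortion_of_inter h2 h.1 h.2 _
    have hsum := Finset.card_le_card (Finset.union_subset
      (nearest_subset A (Icc 0 (1 / 3)))
      (nearest_subset A (Icc (2 / 3) 1)))
    rw [Finset.card_union_of_disjoint (Finset.disjoint_iff_inter_eq_empty.2 h)] at hsum
    -- Points that serve neither half make the sum of the two cardinalities smaller than that of
    -- `A`; monotonicity absorbs them.
    refine (dyadicBound_anti _ hsum).trans ?_
    rw [dyadicBound_succ]
    exact le_distortion_of_nearest hA (fun B hB hc => hc ▸ ih hB) (fun B hB hc => hc ▸ ih hB)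

/-! ### The midpoints of the basic intervals of the Cantor set -/

/-- The midpoints of the `2 ^ k` basic intervals of level `k` of the Cantor set. -/
def midpoints : ℕ → Finset ℝ
  | 0 => {1 / 2}
  | k + 1 => (midpoints k).image cL ∪ (midpoints k).image cR

lemma midpoints_nonempty (k : ℕ) : (midpoints k).Nonempty := by
  induction k with
  | zero => exact Finset.singleton_nonempty _
  | succ k ih => exact (ih.image _).mono Finset.subset_union_left

lemma card_midpoints_le (k : ℕ) : (midpoints k).card ≤ 2 ^ k := by
  induction k with
  | zero => simp [midpoints]
  | succ k ih =>
    refine (Finset.card_union_le _ _).trans ?_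
    have h1 := Finset.card_image_le (s := midpoints k) (f := cL)
    have h2 := Finset.card_image_le (s := midpoints k) (f := cR)
    rw [pow_succ]
    omega

lemma midpoints_subset (k : ℕ) : (midpoints k : Set ℝ) ⊆ Icc 0 1 := by
  induction k with
  | zero => simp [midpoints]; norm_num
  | succ k ih =>
    intro x hx
    simp only [midpoints, Finset.mem_coe, Finset.mem_union, Finset.mem_image] at hx
    rcases hx with ⟨y, hy, rfl⟩ | ⟨y, hy, rfl⟩ <;> obtain ⟨h0, h1⟩ := ih hy
    · unfold cL; constructor <;> linarith
    · unfold cR; constructor <;> linarith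

lemma distortion_midpoints_le (k : ℕ) :
    distortion (midpoints k : Set ℝ) ≤ (1 / 9) ^ k / 8 := by
  induction k with
  | zero =>
    have h : ∀ x, sqDist (midpoints 0) x ≤ (1 * x + -(1 / 2)) ^ 2 := fun x => by
      refine (sqDist_le (b := 1 / 2) (by simp [midpoints]) x).trans (le_of_eq ?_)
      ring
    have h2 := integral_mono_of_Icc (continuous_sqDist (midpoints_nonempty 0)) (by fun_prop)
      fun x _ => h x
    rw [integral_affine_sq] at h2
    rw [distortion_eq]
    norm_num at h2 ⊢
    exact h2
  | succ k ih =>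
    have hne := midpoints_nonempty k
    have hc := continuous_sqDist (midpoints_nonempty (k + 1))
    rw [distortion_eq] at ih ⊢
    rw [integral_eq_add hc]
    have h1 : ∫ x, sqDist (midpoints (k + 1)) (cL x) ∂P ≤ ∫ x, 1 / 9 * sqDist (midpoints k) x ∂P := by
      refine integral_mono_of_Icc (hc.comp continuous_cL)
        (continuous_const.mul (continuous_sqDist hne)) fun x _ => ?_
      rw [← sqDist_image hne (g := cL) (fun x y => by unfold cL; ring) (by norm_num)]
      exact sqDist_anti (hne.image _) Finset.subset_union_left _
    have h2 : ∫ x, sqDist (midpoints (k + 1)) (cR x) ∂P ≤ ∫ x, 1 / 9 * sqDist (midpoints k) x ∂P := by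
      refine integral_mono_of_Icc (hc.comp continuous_cR)
        (continuous_const.mul (continuous_sqDist hne)) fun x _ => ?_
      rw [← sqDist_image hne (g := cR) (fun x y => by unfold cR; ring) (by norm_num)]
      exact sqDist_anti (hne.image _) Finset.subset_union_right _
    rw [integral_const_mul] at h1 h2
    rw [pow_succ]
    linarith

/-! ### The quantization error at powers of two -/

lemma le_distortion_of_ncard_le (k : ℕ) {α : Set ℝ} (h : α.Nonempty) (hf : α.Finite)
    (hc : α.ncard ≤ 2 ^ k) : (1 / 9) ^ k / 8 ≤ distortion α := by
  lift α to Finset ℝ using hf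
  rw [ncard_coe_finset] at hc
  rw [← dyadicBound_two_pow]
  exact (dyadicBound_anti k hc).trans (dyadicBound_le_distortion k (by simpa using h))

lemma distortion_midpoints (k : ℕ) : distortion (midpoints k : Set ℝ) = (1 / 9) ^ k / 8 :=
  (distortion_midpoints_le k).antisymm (le_distortion_of_ncard_le k (by simpa using midpoints_nonempty k)
    (Finset.finite_toSet _) (by simpa [ncard_coe_finset] using card_midpoints_le k))

theorem V_two_pow (k : ℕ) : V (2 ^ k) = (1 / 9) ^ k / 8 := by
  refine IsLeast.csInf_eq ⟨⟨midpoints k, by simpa using midpoints_nonempty k,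
    Finset.finite_toSet _, by simpa [ncard_coe_finset] using card_midpoints_le k,
    (distortion_midpoints k).symm⟩, ?_⟩
  rintro _ ⟨α, h, hf, hc, rfl⟩
  exact le_distortion_of_ncard_le k h hf hc

theorem isOptimal_midpoints (k : ℕ) : IsOptimal (2 ^ k) (midpoints k) :=
  ⟨by simpa using midpoints_nonempty k, Finset.finite_toSet _,
    by simpa [ncard_coe_finset] using card_midpoints_le k,
    by rw [distortion_midpoints, V_two_pow]⟩

/-! ### Conditional expectations -/

/-- The measurable subsets of the unit interval that are not null sets of `P`. -/
def IsCell (B : Set ℝ) : Prop := MeasurableSet B ∧ B ⊆ Icc 0 1 ∧ P B ≠ 0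

lemma P_eq_zero_of_disjoint {s : Set ℝ} (h : ∀ x ∈ s, x ∉ Icc (0 : ℝ) 1) : P s = 0 :=
  measure_mono_null h (ae_iff.1 P_ae_mem)

/-- The factor `1 / 2` cancels in the average, and an affine map commutes with averaging. -/
lemma cell_average_aux {g : ℝ → ℝ} {d : ℝ} (hg : ∀ x, g x = x / 3 + d) {B : Set ℝ} (hB : P B ≠ 0)
    (h : P.restrict (g '' B) = (1 / 2 : ENNReal) • (P.restrict B).map g) :
    P (g '' B) ≠ 0 ∧ ⨍ x in g '' B, x ∂P = g (⨍ x in B, x ∂P) := by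
  have hgc : Continuous g := by
    rw [show g = fun x => x / 3 + d from funext hg]; fun_prop
  have hP : P (g '' B) = 1 / 2 * P B := by
    have := congrArg (fun μ : Measure ℝ => μ univ) h
    simpa [Measure.map_apply hgc.measurable MeasurableSet.univ] using this
  have hr : P.real (g '' B) = 1 / 2 * P.real B := by simp [Measure.real, hP]
  have hr0 : P.real B ≠ 0 := by simpa [Measure.real, ENNReal.toReal_eq_zero_iff] using hB
  refine ⟨by rw [hP]; simpa using hB, ?_⟩
  rw [setAverage_eq, setAverage_eq, h, hr, integral_smul_measure,
    integral_map (f := fun x => x) hgc.aemeasurable continuous_id.aestronglyMeasurable, hg]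
  have hi : IntegrableOn (fun x : ℝ => x) B P :=
    (integrable_of_continuous continuous_id).integrableOn
  simp only [hg]
  rw [integral_add (hi.div_const 3) (integrable_const d), integral_div]
  simp
  field_simp

lemma IsCell.cL {B : Set ℝ} (hB : IsCell B) :
    IsCell (cL '' B) ∧ ⨍ x in cL '' B, x ∂P = CantorInf.cL (⨍ x in B, x ∂P) := by
  obtain ⟨hm, hs, h0⟩ := hB
  have hinj : Function.Injective CantorInf.cL := fun x y h => by
    simp only [CantorInf.cL] at h; linarith
  have hme : MeasurableSet (CantorInf.cL '' B) :=
    (continuous_cL.measurableEmbedding hinj).measurableSet_image.2 hm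
  have h := cell_average_aux (g := CantorInf.cL) (d := 0) (fun x => by simp [CantorInf.cL]) h0 (by
    ext s hs'
    -- The images of the unit interval under `cL` and `cR` are disjoint, so only the `cL` term of
    -- the self-similarity survives.
    have hnull : P (CantorInf.cR ⁻¹' (s ∩ CantorInf.cL '' B)) = 0 := by
      refine P_eq_zero_of_disjoint ?_
      rintro x ⟨-, y, hy, hxy⟩ hx
      simp only [CantorInf.cL, CantorInf.cR] at hxy
      linarith [(hs hy).2, hx.1]
    rw [Measure.restrict_apply hs', P_apply_eq (hs'.inter hme), hnull, preimage_inter,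
      preimage_image_eq _ hinj, Measure.smul_apply, Measure.map_apply continuous_cL.measurable hs',
      Measure.restrict_apply (continuous_cL.measurable hs')]
    simp)
  refine ⟨⟨hme, ?_, h.1⟩, h.2⟩
  rintro _ ⟨x, hx, rfl⟩
  have := hs hx
  simp only [CantorInf.cL]
  constructor <;> linarith [this.1, this.2]

lemma IsCell.cR {B : Set ℝ} (hB : IsCell B) :
    IsCell (cR '' B) ∧ ⨍ x in cR '' B, x ∂P = CantorInf.cR (⨍ x in B, x ∂P) := by
  obtain ⟨hm, hs, h0⟩ := hB
  have hinj : Function.Injective CantorInf.cR := fun x y h => by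
    simp only [CantorInf.cR] at h; linarith
  have hme : MeasurableSet (CantorInf.cR '' B) :=
    (continuous_cR.measurableEmbedding hinj).measurableSet_image.2 hm
  have h := cell_average_aux (g := CantorInf.cR) (d := 2 / 3) (fun x => rfl) h0 (by
    ext s hs'
    have hnull : P (CantorInf.cL ⁻¹' (s ∩ CantorInf.cR '' B)) = 0 := by
      refine P_eq_zero_of_disjoint ?_
      rintro x ⟨-, y, hy, hxy⟩ hx
      simp only [CantorInf.cL, CantorInf.cR] at hxy
      linarith [(hs hy).1, hx.2]
    rw [Measure.restrict_apply hs', P_apply_eq (hs'.inter hme), hnull, preimage_inter,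
      preimage_image_eq _ hinj, Measure.smul_apply, Measure.map_apply continuous_cR.measurable hs',
      Measure.restrict_apply (continuous_cR.measurable hs')]
    simp)
  refine ⟨⟨hme, ?_, h.1⟩, h.2⟩
  rintro _ ⟨x, hx, rfl⟩
  have := hs hx
  simp only [CantorInf.cR]
  constructor <;> linarith [this.1, this.2]

lemma average_of_ae {B : Set ℝ} (hB : MeasurableSet B) (h : P B = 1) : ⨍ x in B, x ∂P = 1 / 2 := by
  have hr : P.restrict B = P := Measure.restrict_eq_self_of_ae_mem ((mem_ae_iff_prob_eq_one hB).2 h)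
  rw [average, hr, measure_univ, inv_one, one_smul, integral_id_P]

lemma P_Icc : P (Icc 0 1) = 1 := (mem_ae_iff_prob_eq_one measurableSet_Icc).1 P_ae_mem

/-! ### Words with a modified first letter -/

lemma J_one_cons (τ : List ℕ+) : J (1 :: τ) = cL '' J τ := by
  simp only [J, wordS, S_one, image_comp]

lemma J_succ_cons (j : ℕ+) (τ : List ℕ+) : J ((j + 1) :: τ) = cR '' J (j :: τ) := by
  simp only [J, wordS, S_succ, image_comp]

lemma JInf_singleton (j : ℕ+) : JInf [j] = ⋃ i : ℕ+, J [j + i] := by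
  ext x
  simp [JInf, succWords]

lemma JInf_cons (j : ℕ+) {τ : List ℕ+} (hτ : τ ≠ []) :
    JInf (j :: τ) = ⋃ σ ∈ succWords τ, J (j :: σ) := by
  ext x
  simp [JInf, succWords, hτ, List.dropLast_cons_of_ne_nil, List.getLast_cons]

lemma JInf_one_cons {τ : List ℕ+} (hτ : τ ≠ []) : JInf (1 :: τ) = cL '' JInf τ := by
  rw [JInf_cons 1 hτ, JInf]
  simp only [image_iUnion, J_one_cons]

lemma JInf_succ_cons (j : ℕ+) (τ : List ℕ+) : JInf ((j + 1) :: τ) = cR '' JInf (j :: τ) := by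
  rcases eq_or_ne τ [] with rfl | hτ
  · rw [JInf_singleton, JInf_singleton, image_iUnion]
    refine iUnion_congr fun i => ?_
    rw [← J_succ_cons, add_right_comm]
  · simp only [JInf_cons _ hτ, image_iUnion, J_succ_cons]

lemma JInf_one : JInf [1] = cR '' ⋃ i : ℕ+, J [i] := by
  rw [JInf_singleton, image_iUnion]
  refine iUnion_congr fun i => ?_
  rw [← J_succ_cons, add_comm]

lemma measurableSet_J (ω : List ℕ+) : MeasurableSet (J ω) := by
  have hc : Continuous (wordS ω) := by
    induction ω with
    | nil => exact continuous_id
    | cons j ω ih => exact (S_continuous j).comp ih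
  exact (isCompact_Icc.image hc).measurableSet

/-- The union `U` contains `cL '' Icc 0 1` and is mapped into itself by `cR`, so `P U ≥ 1 / 2 + P U
/ 2`. -/
lemma P_iUnion_J : P (⋃ i : ℕ+, J [i]) = 1 := by
  have hm : MeasurableSet (⋃ i : ℕ+, J [i]) := MeasurableSet.iUnion fun i => measurableSet_J _
  have h := P_apply_eq hm
  have hL : P (cL ⁻¹' ⋃ i : ℕ+, J [i]) = 1 := by
    refine le_antisymm prob_le_one (P_Icc ▸ measure_mono fun x hx => ?_)
    refine mem_iUnion.2 ⟨1, ?_⟩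
    rw [J_one_cons]
    exact mem_image_of_mem _ (by simpa [J, wordS] using hx)
  have hR : P (⋃ i : ℕ+, J [i]) ≤ P (cR ⁻¹' ⋃ i : ℕ+, J [i]) := by
    refine measure_mono fun x hx => ?_
    obtain ⟨i, hi⟩ := mem_iUnion.1 hx
    refine mem_iUnion.2 ⟨i + 1, ?_⟩
    rw [J_succ_cons]
    exact mem_image_of_mem _ hi
  have h' : P.real (⋃ i : ℕ+, J [i]) = 1 / 2 + 1 / 2 * P.real (cR ⁻¹' ⋃ i : ℕ+, J [i]) := by
    simp only [Measure.real]
    rw [h, hL, ENNReal.toReal_add (by finiteness) (by finiteness)]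
    simp
  have hR' : P.real (⋃ i : ℕ+, J [i]) ≤ P.real (cR ⁻¹' ⋃ i : ℕ+, J [i]) :=
    ENNReal.toReal_mono (by finiteness) hR
  have h1 : P.real (⋃ i : ℕ+, J [i]) = 1 :=
    le_antisymm measureReal_le_one (by linarith)
  exact (ENNReal.toReal_eq_one_iff _).1 h1

/-- Induction on words by decreasing the first letter. -/
lemma word_induction {C : List ℕ+ → Prop} (nil : C [])
    (one : ∀ τ, C τ → C (1 :: τ)) (succ : ∀ j τ, C (j :: τ) → C ((j + 1) :: τ)) (ω : List ℕ+) :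
    C ω := by
  induction ω with
  | nil => exact nil
  | cons j τ ih =>
    induction j using PNat.recOn with
    | one => exact one τ ih
    | succ j hj => exact succ j τ hj

lemma isCell_J (ω : List ℕ+) : IsCell (J ω) := by
  refine word_induction (C := fun ω => IsCell (J ω)) ?_ (fun τ h => ?_) (fun j τ h => ?_) ω
  · refine ⟨measurableSet_J _, by simp [J, wordS], ?_⟩
    simp [J, wordS, P_Icc]
  · exact J_one_cons τ ▸ h.cL.1
  · exact J_succ_cons j τ ▸ h.cR.1

lemma isCell_iUnion_J : IsCell (⋃ i : ℕ+, J [i]) :=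
  ⟨MeasurableSet.iUnion fun i => measurableSet_J _, iUnion_subset fun i => (isCell_J _).2.1,
    by simp [P_iUnion_J]⟩

lemma isCell_JInf (ω : List ℕ+) (hω : ω ≠ []) : IsCell (JInf ω) := by
  revert hω
  refine word_induction (C := fun ω => ω ≠ [] → IsCell (JInf ω)) (by simp) (fun τ h _ => ?_)
    (fun j τ h _ => ?_) ω
  · rcases eq_or_ne τ [] with rfl | hτ
    · exact JInf_one ▸ isCell_iUnion_J.cR.1
    · exact JInf_one_cons hτ ▸ (h hτ).cL.1
  · exact JInf_succ_cons j τ ▸ (h (by simp)).cR.1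

lemma a_nil : a [] = 1 / 2 := by
  simp only [a, J, wordS, image_id]
  exact average_of_ae measurableSet_Icc P_Icc

lemma a_one_cons (τ : List ℕ+) : a (1 :: τ) = cL (a τ) := by
  rw [a, J_one_cons, (isCell_J τ).cL.2, a]

lemma a_succ_cons (j : ℕ+) (τ : List ℕ+) : a ((j + 1) :: τ) = cR (a (j :: τ)) := by
  rw [a, J_succ_cons, (isCell_J _).cR.2, a]

/-- `JInf [1]` is the `cR`-image of a set of full measure, whose mean is that of `P`. This is where
the last left move turns into a right move. -/
lemma aInf_one : aInf [1] = cR (1 / 2) := by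
  rw [aInf, JInf_one, isCell_iUnion_J.cR.2, average_of_ae isCell_iUnion_J.1 P_iUnion_J]

lemma aInf_one_cons {τ : List ℕ+} (hτ : τ ≠ []) : aInf (1 :: τ) = cL (aInf τ) := by
  rw [aInf, JInf_one_cons hτ, (isCell_JInf τ hτ).cL.2, aInf]

lemma aInf_succ_cons (j : ℕ+) (τ : List ℕ+) : aInf ((j + 1) :: τ) = cR (aInf (j :: τ)) := by
  rw [aInf, JInf_succ_cons, (isCell_JInf _ (by simp)).cR.2, aInf]

lemma wordP_one_cons (τ : List ℕ+) : wordP (1 :: τ) = 1 / 2 * wordP τ := by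
  simp [wordP, p]

lemma wordP_succ_cons (j : ℕ+) (τ : List ℕ+) :
    wordP ((j + 1) :: τ) = 1 / 2 * wordP (j :: τ) := by
  simp [wordP, p_succ, mul_assoc]

lemma wordP_cons_le (j : ℕ+) (τ : List ℕ+) : wordP (j :: τ) ≤ 1 / 2 := by
  have h : ∀ ω, 0 ≤ wordP ω ∧ wordP ω ≤ 1 ∧ (ω ≠ [] → wordP ω ≤ 1 / 2) := by
    refine word_induction ?_ (fun τ h => ?_) fun j τ h => ?_
    · simp [wordP]
    · rw [wordP_one_cons]
      exact ⟨by linarith [h.1], by linarith [h.2.1], fun _ => by linarith [h.2.1]⟩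
    · rw [wordP_succ_cons]
      exact ⟨by linarith [h.1], by linarith [h.2.1], fun _ => by linarith [h.2.1]⟩
  exact (h _).2.2 (by simp)

lemma half_mul_eq_iff (x : ℝ) (k : ℕ) : 1 / 2 * x = 1 / 2 ^ (k + 1) ↔ x = 1 / 2 ^ k := by
  rw [pow_succ]
  constructor <;> intro h
  · field_simp at h ⊢; linarith
  · rw [h]; field_simp

/-- The values of `e` at the words of weight `1 / 2 ^ k`. -/
def values (e : List ℕ+ → ℝ) (k : ℕ) : Set ℝ := {x | ∃ ω : List ℕ+, wordP ω = 1 / 2 ^ k ∧ x = e ω}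

lemma alpha_eq (k : ℕ) : alpha k = values a k ∪ values aInf k := rfl

lemma values_one (e : List ℕ+ → ℝ) : values e 1 = {e [1]} := by
  refine Subset.antisymm ?_ ?_
  · rintro _ ⟨ω, hω, rfl⟩
    revert hω
    refine word_induction (C := fun ω => wordP ω = 1 / 2 ^ 1 → e ω ∈ ({e [1]} : Set ℝ)) ?_ ?_ ?_ ω
    · intro h; norm_num [wordP] at h
    · intro τ _ h
      rw [wordP_one_cons, half_mul_eq_iff] at h
      cases τ with
      | nil => rfl
      | cons j τ => linarith [wordP_cons_le j τ]
    · intro j τ _ h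
      rw [wordP_succ_cons, half_mul_eq_iff] at h
      -- A nonempty word cannot have weight `1`.
      linarith [wordP_cons_le j τ]
  · rintro _ rfl
    exact ⟨[1], by simp [wordP, p], rfl⟩

/-- The empty word is excluded in `h1` because `aInf [1]` lies in the right half; `1 ≤ k` keeps it
from occurring. -/
lemma values_succ {e : List ℕ+ → ℝ} (h1 : ∀ τ, τ ≠ [] → e (1 :: τ) = cL (e τ))
    (hs : ∀ j τ, e ((j + 1) :: τ) = cR (e (j :: τ))) {k : ℕ} (hk : 1 ≤ k) :
    values e (k + 1) = cL '' values e k ∪ cR '' values e k := by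
  have hne : ∀ n : ℕ, 1 ≤ n → ∀ ω, wordP ω = 1 / 2 ^ n → ω ≠ [] := by
    rintro n hn _ h rfl
    have h2 : (1 : ℝ) < 2 ^ n := one_lt_pow₀ (by norm_num) (by omega)
    simp only [wordP, List.map_nil, List.prod_nil] at h
    field_simp at h
    linarith
  refine Subset.antisymm ?_ (union_subset ?_ ?_)
  · rintro _ ⟨ω, hω, rfl⟩
    revert hω
    refine word_induction (C := fun ω => wordP ω = 1 / 2 ^ (k + 1) →
      e ω ∈ cL '' values e k ∪ cR '' values e k) ?_ ?_ ?_ ω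
    · intro h; exact absurd rfl (hne _ (by omega) _ h)
    · intro τ _ h
      rw [wordP_one_cons, half_mul_eq_iff] at h
      exact Or.inl ⟨e τ, ⟨τ, h, rfl⟩, (h1 τ (hne k hk τ h)).symm⟩
    · intro j τ _ h
      rw [wordP_succ_cons, half_mul_eq_iff] at h
      exact Or.inr ⟨e (j :: τ), ⟨_, h, rfl⟩, (hs j τ).symm⟩
  · rintro _ ⟨_, ⟨τ, h, rfl⟩, rfl⟩
    exact ⟨1 :: τ, by rw [wordP_one_cons, half_mul_eq_iff, h], (h1 τ (hne k hk τ h)).symm⟩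
  · rintro _ ⟨_, ⟨τ, h, rfl⟩, rfl⟩
    cases τ with
    | nil => exact absurd rfl (hne k hk _ h)
    | cons j τ =>
      exact ⟨(j + 1) :: τ, by rw [wordP_succ_cons, half_mul_eq_iff, h], (hs j τ).symm⟩

/-- `α(k)` is the set of midpoints of the basic intervals of level `k` of the Cantor set. -/
theorem alpha_eq_midpoints {k : ℕ} (hk : 1 ≤ k) : alpha k = midpoints k := by
  induction k, hk using Nat.le_induction with
  | base =>
    rw [alpha_eq, values_one, values_one, a_one_cons, a_nil, aInf_one]
    simp [midpoints, pair_comm]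
  | succ k hk ih =>
    rw [alpha_eq, values_succ (fun τ _ => a_one_cons τ) a_succ_cons hk,
      values_succ (fun τ h => aInf_one_cons h) aInf_succ_cons hk]
    simp only [midpoints, Finset.coe_union, Finset.coe_image, ← ih, alpha_eq, image_union]
    ext x
    simp only [mem_union]
    tauto

/-- Each step of the induction on `j` peels off one map `cL` or `cR`; the midpoints in the other
half miss `J [j]`. -/
lemma preimage_S_midpoints (j : ℕ+) {k : ℕ} (hj : (j : ℕ) ≤ k) :
    S j ⁻¹' ((midpoints k : Set ℝ) ∩ J [j]) = midpoints (k - (j : ℕ)) := by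
  induction j using PNat.recOn generalizing k with
  | one =>
    obtain ⟨k, rfl⟩ : ∃ n, k = n + 1 := ⟨k - 1, by simp at hj; omega⟩
    rw [S_one, J_one_cons]
    ext x
    simp only [midpoints, mem_preimage, mem_inter_iff, Finset.coe_union, Finset.coe_image, mem_union,
      mem_image, J, wordS, image_id, PNat.one_coe, Nat.add_sub_cancel, Finset.mem_coe, id]
    constructor
    · rintro ⟨⟨y, hy, hxy⟩ | ⟨y, hy, hxy⟩, z, hz, hzx⟩
      · have : y = x := by simp only [cL] at hxy; linarith
        exact this ▸ hy
      · have := midpoints_subset k hy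
        simp only [cL, cR] at hxy hzx
        linarith [this.1, hz.2]
    · intro hx
      exact ⟨Or.inl ⟨x, hx, rfl⟩, x, midpoints_subset k hx, rfl⟩
  | succ j ih =>
    obtain ⟨k, rfl⟩ : ∃ n, k = n + 1 := ⟨k - 1, by simp at hj; omega⟩
    have hk : k + 1 - ((j + 1 : ℕ+) : ℕ) = k - (j : ℕ) := by simp
    rw [hk, ← ih (by simpa using hj), S_succ, J_succ_cons, preimage_comp]
    congr 1
    ext x
    simp only [midpoints, mem_preimage, mem_inter_iff, Finset.coe_union, Finset.coe_image, mem_union,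
      mem_image, Finset.mem_coe]
    constructor
    · rintro ⟨⟨y, hy, hxy⟩ | ⟨y, hy, hxy⟩, z, hz, hzx⟩
      · have h1 := midpoints_subset k hy
        have h2 := (isCell_J [j]).2.1 hz
        simp only [cL, cR] at hxy hzx
        linarith [h1.2, h2.1]
      · have hy' : y = x := by simp only [cR] at hxy; linarith
        have hz' : z = x := by simp only [cR] at hzx; linarith
        exact ⟨hy' ▸ hy, hz' ▸ hz⟩
    · rintro ⟨hx, hx'⟩
      exact ⟨Or.inr ⟨x, hx, rfl⟩, x, hx', rfl⟩

/-! ### The two summation formulas -/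

lemma two_pow_eq_sum (k : ℕ) : (2 : ℕ) ^ k = (∑ j ∈ Finset.Icc 1 k, 2 ^ (k - j)) + 1 := by
  induction k with
  | zero => simp
  | succ k ih =>
    have h : ∑ j ∈ Finset.Icc 1 k, 2 ^ (k + 1 - j) = 2 * ∑ j ∈ Finset.Icc 1 k, 2 ^ (k - j) := by
      rw [Finset.mul_sum]
      refine Finset.sum_congr rfl fun j hj => ?_
      rw [Nat.sub_add_comm (Finset.mem_Icc.1 hj).2, pow_succ']
    rw [Finset.sum_Icc_succ_top (by omega), h, pow_succ']
    simp
    omega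

lemma V_two_pow_eq_sum (k : ℕ) :
    V (2 ^ k) = (∑ j ∈ Finset.Icc 1 k, 1 / 18 ^ j * V (2 ^ (k - j))) + 1 / 18 ^ k * V 1 := by
  have h1 : V 1 = 1 / 8 := by simpa using V_two_pow 0
  rw [h1]
  simp only [V_two_pow]
  induction k with
  | zero => norm_num
  | succ k ih =>
    have h : ∑ j ∈ Finset.Icc 1 k, (1 : ℝ) / 18 ^ j * ((1 / 9) ^ (k + 1 - j) / 8) =
        1 / 9 * ∑ j ∈ Finset.Icc 1 k, (1 : ℝ) / 18 ^ j * ((1 / 9) ^ (k - j) / 8) := by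
      rw [Finset.mul_sum]
      refine Finset.sum_congr rfl fun j hj => ?_
      rw [Nat.sub_add_comm (Finset.mem_Icc.1 hj).2, pow_succ']
      ring
    -- The induction hypothesis replaces the sum by `(1 / 9) ^ k / 8` minus the last term.
    rw [Finset.sum_Icc_succ_top (by omega), h, ← sub_eq_of_eq_add ih, pow_succ (1 / 9 : ℝ),
      pow_succ (18 : ℝ)]
    simp
    field_simp
    ring

end CantorInf

end

theorem lemma14 (k : ℕ) (hk : 1 ≤ k) :
    CantorInf.IsOptimal (2 ^ k) (CantorInf.alpha k) ∧
    (∀ j : ℕ+, (j : ℕ) ≤ k → CantorInf.IsOptimal (2 ^ (k - (j : ℕ)))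
      (CantorInf.S j ⁻¹' (CantorInf.alpha k ∩ CantorInf.J [j]))) ∧
    (2 : ℕ) ^ k = (∑ j ∈ Finset.Icc 1 k, 2 ^ (k - j)) + 1 ∧
    CantorInf.V (2 ^ k) =
      (∑ j ∈ Finset.Icc 1 k, 1 / 18 ^ j * CantorInf.V (2 ^ (k - j))) +
        1 / 18 ^ k * CantorInf.V 1 := by
  rw [CantorInf.alpha_eq_midpoints hk]
  refine ⟨CantorInf.isOptimal_midpoints k, fun j hj => ?_, CantorInf.two_pow_eq_sum k,
    CantorInf.V_two_pow_eq_sum k⟩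
  rw [CantorInf.preimage_S_midpoints j hj]
  exact CantorInf.isOptimal_midpoints _
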